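/- Let $a>0$, $\mathbf v_1=a(\tfrac{\sqrt3}{2},\tfrac12)$, $\mathbf v_2=a(\tfrac{\sqrt3}{2},-\tfrac12)$, $\Lambda=\mathbb Z\mathbf v_1\oplus\mathbb Z\mathbf v_2$, $\Gamma=\mathbb R^2/\Lambda$, $\mathbf x_0=\tfrac23(\mathbf v_1+\mathbf v_2)$, and $Y=\{\mathbf y_1,\mathbf y_2\}=\{\mathbf 0,\mathbf x_0\}$, so that $\Lambda+Y$ is the honeycomb lattice. Let $\mathbf k_1,\mathbf k_2$ be the dual basis, $\mathbf k_i\cdot\mathbf v_j=2\pi\delta_{ij}$, and $\xi_{\mathbf m}=m_1\mathbf k_1+m_2\mathbf k_2$ for $\mathbf m\in\mathbb Z^2$; put $\mathrm{area}(\Gamma)=\tfrac{\sqrt3}{2}a^2$ and $\mathrm{area}(\mathcal B)=(2\pi)^2/\mathrm{area}(\Gamma)$. For $\mathbf k\in\mathbb R^2$ let $L^2_{\mathbf k}(\Gamma)$ be the space of locally square-integrable $f$ with $f(\mathbf x+\mathbf v_j)=e^{i\mathbf k\cdot\mathbf v_j}f(\mathbf x)$, with inner product $(f,g)=\int_\Gamma\overline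 f g$, and let $-\Delta(\mathbf k)$ be the Laplacian in $L^2_{\mathbf k}(\Gamma)$ with domain $H^2_{\mathbf k}(\Gamma)$, i.e. multiplication of the Fourier coefficients with respect to $e^{i(\xi_{\mathbf m}+\mathbf k)\cdot\mathbf x}$ by $|\xi_{\mathbf m}+\mathbf k|^2$. For $\lambda\in\mathbb C\setminus\sigma(-\Delta(\mathbf k))$ put $$g_\lambda(\mathbf x,\mathbf k)=\frac1{\mathrm{area}(\Gamma)}\lim_{r\to\infty}\sum_{|\xi_{\mathbf m}+\mathbf k|\le r}\frac{e^{i(\xi_{\mathbf m}+\mathbf k)\cdot\mathbf x}}{|\xi_{\mathbf m}+\mathbf k|^2-\lambda}\quad(\mathbf x\notin\Lambda),$$ $$g_\lambda(\mathbf x,\mathbf k)=\frac1{\mathrm{area}(\Gamma)}\lim_{r\to\infty}\Big[\sum_{|\xi_{\mathbf m}+\mathbf k|\le r}\frac{1}{|\xi_{\mathbf m}+\mathbf k|^2-\lambda}-\frac{2\pi}{\mathrm{area}(\mathcal B)}\ln r\Big]\quad(\mathbf x\in\Lambda).$$ For $\alpha\in\mathbb R$ let $\Gamma_{\alpha,Y}(\lambda,\mathbf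 k)$ be the $2\times2$ matrix with entries $\alpha\,\delta_{jj'}-g_\lambda(\mathbf y_{j'}-\mathbf y_j,\mathbf k)$, and let $-\Delta_{\alpha,Y}(\mathbf k)$ be the self-adjoint operator in $L^2_{\mathbf k}(\Gamma)$ (the fiber operator of the honeycomb point scatterers of equal strength $\alpha$) with resolvent $$(-\Delta_{\alpha,Y}(\mathbf k)-\lambda)^{-1}f=(-\Delta(\mathbf k)-\lambda)^{-1}f+\sum_{j,j'=1}^2\big[\Gamma_{\alpha,Y}(\lambda,\mathbf k)^{-1}\big]_{jj'}\big(g_{\bar\lambda}(\cdot-\mathbf y_j,\mathbf k),f\big)\,g_\lambda(\cdot-\mathbf y_{j'},\mathbf k)$$ for all $\lambda\notin\sigma(-\Delta(\mathbf k))$ for which $\Gamma_{\alpha,Y}(\lambda,\mathbf k)$ is invertible. Proposition. Let $\alpha\in\mathbb R$, $\mathbf k\in\mathbb R^2$, and let $\lambda'\in\mathbb C$ with $\lambda'\notin\sigma(-\Delta(\mathbf k))$. Then $\lambda'\in\sigma(-\Delta_{\alpha,Y}(\mathbf k))$ if and only if $$\alpha=g_{\lambda'}(\mathbf 0,\mathbf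 k)+|g_{\lambda'}(\mathbf x_0,\mathbf k)|\quad\text{or}\quad\alpha=g_{\lambda'}(\mathbf 0,\mathbf k)-|g_{\lambda'}(\mathbf x_0,\mathbf k)|.$$ In addition, the multiplicity of $\lambda'$ as an eigenvalue of $-\Delta_{\alpha,Y}(\mathbf k)$ satisfies $$\dim\ker\big(-\Delta_{\alpha,Y}(\mathbf k)-\lambda'\big)=\dim\ker\Gamma_{\alpha,Y}(\lambda',\mathbf k).$$ -/

import Mathlib

open MeasureTheory Filter Topology

noncomputable section

namespace HoneycombPointScatterer

/-! ### Lattices -/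

/-- The plane `ℝ²` with its Euclidean norm and Lebesgue measure. -/
abbrev Plane : Type := EuclideanSpace ℝ (Fin 2)

/-- The lattice vector `v₁ = a (√3/2, 1/2)`. -/
def v₁ (a : ℝ) : Plane := a • !₂[√3 / 2, 1 / 2]

/-- The lattice vector `v₂ = a (√3/2, -1/2)`. -/
def v₂ (a : ℝ) : Plane := a • !₂[√3 / 2, -(1 / 2)]

/-- The dual vector `k₁ = 4π/(a√3) (1/2, √3/2)`. -/
def k₁ (a : ℝ) : Plane := (4 * Real.pi / (a * √3)) • !₂[1 / 2, √3 / 2]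

/-- The dual vector `k₂ = 4π/(a√3) (1/2, -√3/2)`. -/
def k₂ (a : ℝ) : Plane := (4 * Real.pi / (a * √3)) • !₂[1 / 2, -(√3 / 2)]

/-- The triangular lattice `Λ = ℤ v₁ ⊕ ℤ v₂`. -/
def triangularLattice (a : ℝ) : Set Plane :=
  Set.range fun m : ℤ × ℤ => (m.1 : ℝ) • v₁ a + (m.2 : ℝ) • v₂ a

/-- The dual lattice vector `ξ_m = m₁ k₁ + m₂ k₂`. -/
def dualVec (a : ℝ) (m : ℤ × ℤ) : Plane := (m.1 : ℝ) • k₁ a + (m.2 : ℝ) • k₂ a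

/-- The second scatterer `x₀ = (2/3) (v₁ + v₂)` of the honeycomb cell. -/
def x₀ (a : ℝ) : Plane := (2 / 3 : ℝ) • (v₁ a + v₂ a)

/-- The two scatterers `y₁ = 0`, `y₂ = x₀` in the fundamental cell. -/
def site (a : ℝ) : Fin 2 → Plane := ![0, x₀ a]

/-- The half-open parallelogram spanned by `v₁, v₂`, a fundamental domain `Γ` of `ℝ²/Λ`. -/
def cell (a : ℝ) : Set Plane :=
  {x | ∃ s ∈ Set.Ico (0 : ℝ) 1, ∃ t ∈ Set.Ico (0 : ℝ) 1, x = s • v₁ a + t • v₂ a}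

/-- `area(Γ) = |v₁ × v₂| = a² √3 / 2`. -/
def areaCell (a : ℝ) : ℝ := a ^ 2 * √3 / 2

/-- `area(𝓑) = |k₁ × k₂| = (2π)² / area(Γ)`, the area of a fundamental domain of the dual
lattice (in particular of the Brillouin zone). -/
def areaBrillouin (a : ℝ) : ℝ := (2 * Real.pi) ^ 2 / areaCell a

/-! ### Unbounded operators on a Hilbert space: spectrum and eigenspaces -/

section Operators

variable {H : Type*} [NormedAddCommGroup H] [InnerProductSpace ℂ H]

/-- The spectrum of an unbounded operator `T`: the complement of the set of all `z` for which
`T - z` has a bounded everywhere defined two-sided inverse `R`. -/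
def opSpectrum (T : H →ₗ.[ℂ] H) : Set ℂ :=
  {z | ¬ ∃ R : H →L[ℂ] H,
    (∀ f : H, ∃ u : T.domain, (u : H) = R f ∧ T u - z • (u : H) = f) ∧
    ∀ u : T.domain, R (T u - z • (u : H)) = u}

/-- The eigenspace `ker (T - z)` of an unbounded operator `T`. -/
def opEigenspace (T : H →ₗ.[ℂ] H) (z : ℂ) : Submodule ℂ T.domain :=
  LinearMap.ker (T.toFun - z • T.domain.subtype)

end Operators

/-! ### The space `L²_k(Γ)` and the Floquet Laplacian -/

/-- The Hilbert space `L²_k(Γ)`. A `k`-quasi-periodic function, `f(x + v_j) = e^{i k·v_j} f(x)`,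
is determined by its restriction to the fundamental cell, and every function on the cell extends
in exactly one way; so `L²_k(Γ)` is `L²` of the cell, with inner product `∫_Γ conj(f) g`. -/
abbrev L2Cell (a : ℝ) : Type := Lp ℂ 2 ((volume : Measure Plane).restrict (cell a))

lemma cell_subset_closedBall (a : ℝ) :
    cell a ⊆ Metric.closedBall 0 (‖v₁ a‖ + ‖v₂ a‖) := by
  rintro x ⟨s, hs, t, ht, rfl⟩
  rw [mem_closedBall_zero_iff]
  refine (norm_add_le _ _).trans ?_
  rw [norm_smul, norm_smul, Real.norm_of_nonneg hs.1, Real.norm_of_nonneg ht.1]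
  exact add_le_add (mul_le_of_le_one_left (norm_nonneg _) hs.2.le)
    (mul_le_of_le_one_left (norm_nonneg _) ht.2.le)

instance isFiniteMeasure_cell (a : ℝ) :
    IsFiniteMeasure ((volume : Measure Plane).restrict (cell a)) :=
  isFiniteMeasure_restrict.2
    ((measure_mono (cell_subset_closedBall a)).trans_lt measure_closedBall_lt_top).ne

/-- The plane wave `x ↦ e^{i ξ·x}`. -/
def planeWave (ξ x : Plane) : ℂ := Complex.exp (Complex.I * ((inner ℝ ξ x : ℝ) : ℂ))

lemma memLp_planeWave (a : ℝ) (ξ : Plane) :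
    MemLp (planeWave ξ) 2 ((volume : Measure Plane).restrict (cell a)) := by
  refine MemLp.of_bound (C := 1) ?_ ?_
  · have h : Continuous (planeWave ξ) := by unfold planeWave; fun_prop
    exact h.aestronglyMeasurable
  · refine Eventually.of_forall fun x => ?_
    rw [planeWave, mul_comm, Complex.norm_exp_ofReal_mul_I]

/-- The Bloch wave `x ↦ e^{i (ξ_m + k)·x}` as an element of `L²_k(Γ)`. -/
def blochWave (a : ℝ) (k : Plane) (m : ℤ × ℤ) : L2Cell a :=
  (memLp_planeWave a (dualVec a m + k)).toLp _

/-- The graph of `-Δ(k)`: the pairs `(f, h)` in `L²_k(Γ)` such that the Fourier coefficients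
satisfy `(e^{i(ξ_m+k)·x}, h) = |ξ_m + k|² (e^{i(ξ_m+k)·x}, f)` for all `m`. -/
def floquetLaplacianGraph (a : ℝ) (k : Plane) : Submodule ℂ (L2Cell a × L2Cell a) where
  carrier := {p | ∀ m : ℤ × ℤ, inner ℂ (blochWave a k m) p.2 =
    ((‖dualVec a m + k‖ ^ 2 : ℝ) : ℂ) * inner ℂ (blochWave a k m) p.1}
  zero_mem' := by intro m; simp
  add_mem' := by
    intro p q hp hq m
    simp only [Prod.fst_add, Prod.snd_add, inner_add_right, hp m, hq m, mul_add]
  smul_mem' := by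
    intro c p hp m
    simp only [Prod.smul_fst, Prod.smul_snd, inner_smul_right, hp m]
    ring

/-- The nonnegative Laplacian `-Δ(k)` in `L²_k(Γ)` with Floquet boundary condition. Its domain is
`H²_k(Γ)`, the set of those `f` for which `∑ |ξ_m + k|⁴ |f_m|² < ∞`. -/
def floquetLaplacian (a : ℝ) (k : Plane) : L2Cell a →ₗ.[ℂ] L2Cell a :=
  (floquetLaplacianGraph a k).toLinearPMap

/-! ### Green's function and the matrix `Γ_{α,Y}` -/

/-- The `m`-th term `e^{i(ξ_m+k)·x} / (|ξ_m+k|² - lam)`. -/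
def greenTerm (a : ℝ) (k : Plane) (lam : ℂ) (x : Plane) (m : ℤ × ℤ) : ℂ :=
  planeWave (dualVec a m + k) x / (((‖dualVec a m + k‖ ^ 2 : ℝ) : ℂ) - lam)

open scoped Classical in
/-- `g_lam(x, k)`. Off the lattice it is
`area(Γ)⁻¹ ∑_m e^{i(ξ_m+k)·x} / (|ξ_m+k|² - lam)`; the series converges only conditionally and is
summed over the growing discs `|ξ_m+k| ≤ r`. On the lattice it is the renormalized limit
`area(Γ)⁻¹ lim_{r→∞} [∑_{|ξ_m+k| ≤ r} 1 / (|ξ_m+k|² - lam) - (2π / area(𝓑)) log r]`. -/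
def green (a : ℝ) (k : Plane) (lam : ℂ) (x : Plane) : ℂ :=
  if x ∈ triangularLattice a then
    (areaCell a : ℂ)⁻¹ * limUnder atTop fun r : ℝ =>
      (∑ᶠ m ∈ {m : ℤ × ℤ | ‖dualVec a m + k‖ ≤ r},
        1 / (((‖dualVec a m + k‖ ^ 2 : ℝ) : ℂ) - lam)) -
        ((2 * Real.pi / areaBrillouin a * Real.log r : ℝ) : ℂ)
  else
    (areaCell a : ℂ)⁻¹ * limUnder atTop fun r : ℝ =>
      ∑ᶠ m ∈ {m : ℤ × ℤ | ‖dualVec a m + k‖ ≤ r}, greenTerm a k lam x m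

/-- The function `x ↦ g_lam(x - y, k)` as an element of `L²_k(Γ)`: here the series
`area(Γ)⁻¹ ∑_m e^{i(ξ_m+k)·(x-y)} / (|ξ_m+k|² - lam)` converges in `L²`. -/
def greenL2 (a : ℝ) (k : Plane) (lam : ℂ) (y : Plane) : L2Cell a :=
  (areaCell a : ℂ)⁻¹ • ∑' m : ℤ × ℤ, greenTerm a k lam (-y) m • blochWave a k m

/-- The matrix `[Γ_{α,Y}(lam, k)]_{jj'} = α_j δ_{jj'} - g_lam(y_{j'} - y_j, k)`. -/
def gammaMatrix (a : ℝ) (α : Fin 2 → ℝ) (k : Plane) (lam : ℂ) : Matrix (Fin 2) (Fin 2) ℂ :=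
  Matrix.of fun j j' =>
    (if j = j' then (α j : ℂ) else 0) - green a k lam (site a j' - site a j)

/-! ### The fiber operator of the honeycomb point scatterers -/

/-- The part of Krein's resolvent formula carried by the scatterers:
`f ↦ ∑_{j,j'} [Γ_{α,Y}(lam,k)⁻¹]_{jj'} (g_{conj lam}(• - y_j, k), f) g_lam(• - y_{j'}, k)`. -/
def kreinTerm (a : ℝ) (α : Fin 2 → ℝ) (k : Plane) (lam : ℂ) (f : L2Cell a) : L2Cell a :=
  ∑ j : Fin 2, ∑ j' : Fin 2,
    ((gammaMatrix a α k lam)⁻¹ j j' *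
      inner ℂ (greenL2 a k (starRingEnd ℂ lam) (site a j)) f) • greenL2 a k lam (site a j')

lemma kreinTerm_add (a : ℝ) (α : Fin 2 → ℝ) (k : Plane) (lam : ℂ) (f g : L2Cell a) :
    kreinTerm a α k lam (f + g) = kreinTerm a α k lam f + kreinTerm a α k lam g := by
  simp only [kreinTerm, inner_add_right, mul_add, add_smul, Finset.sum_add_distrib]

lemma kreinTerm_smul (a : ℝ) (α : Fin 2 → ℝ) (k : Plane) (lam c : ℂ) (f : L2Cell a) :
    kreinTerm a α k lam (c • f) = c • kreinTerm a α k lam f := by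
  simp only [kreinTerm, inner_smul_right, Finset.smul_sum, smul_smul]
  refine Finset.sum_congr rfl fun j _ => Finset.sum_congr rfl fun j' _ => ?_
  congr 1
  ring

/-- The graph of the fiber operator `A = -Δ_{α,Y}(k)`, `Y = {0, x₀}`, which is given by its
resolvent
`(A - lam)⁻¹ f = (-Δ(k) - lam)⁻¹ f + kreinTerm f`
for every `lam ∉ σ(-Δ(k))` with invertible `Γ_{α,Y}(lam, k)`. A pair `(ψ, h)` lies in the graph of
`A` iff `ψ = (A - lam)⁻¹ (h - lam ψ)`; below `φ = (-Δ(k) - lam)⁻¹ (h - lam ψ)`. -/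
def pointScattererGraph (a : ℝ) (α : Fin 2 → ℝ) (k : Plane) :
    Submodule ℂ (L2Cell a × L2Cell a) where
  carrier := {p | ∀ lam : ℂ, lam ∉ opSpectrum (floquetLaplacian a k) →
    IsUnit (gammaMatrix a α k lam).det →
    ∃ φ : (floquetLaplacian a k).domain,
      floquetLaplacian a k φ - lam • (φ : L2Cell a) = p.2 - lam • p.1 ∧
      p.1 = φ + kreinTerm a α k lam (p.2 - lam • p.1)}
  zero_mem' := by
    intro lam _ _
    refine ⟨0, ?_, ?_⟩
    · simp
    · simpa using (kreinTerm_smul a α k lam 0 0).symm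
  add_mem' := by
    intro p q hp hq lam h1 h2
    obtain ⟨φ, hφ, hφ'⟩ := hp lam h1 h2
    obtain ⟨χ, hχ, hχ'⟩ := hq lam h1 h2
    have e : (p + q).2 - lam • (p + q).1 = (p.2 - lam • p.1) + (q.2 - lam • q.1) := by
      simp only [Prod.fst_add, Prod.snd_add, smul_add]
      abel
    refine ⟨φ + χ, ?_, ?_⟩
    · rw [e, ← hφ, ← hχ, LinearPMap.map_add, Submodule.coe_add, smul_add]
      abel
    · rw [e, kreinTerm_add, Submodule.coe_add, Prod.fst_add]
      nth_rewrite 1 [hφ', hχ']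
      abel
  smul_mem' := by
    intro c p hp lam h1 h2
    obtain ⟨φ, hφ, hφ'⟩ := hp lam h1 h2
    have e : (c • p).2 - lam • (c • p).1 = c • (p.2 - lam • p.1) := by
      simp only [Prod.smul_fst, Prod.smul_snd, smul_sub, smul_comm c lam]
    refine ⟨c • φ, ?_, ?_⟩
    · rw [e, ← hφ, LinearPMap.map_smul, Submodule.coe_smul, smul_sub, smul_comm c lam]
    · rw [e, kreinTerm_smul, Submodule.coe_smul, Prod.smul_fst, ← smul_add, ← hφ']

/-- The fiber operator `-Δ_{α,Y}(k)` in `L²_k(Γ)` for point scatterers on `Y = {0, x₀}` with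
parameters `α = (α₁, α₂)`. -/
def pointScatterer (a : ℝ) (α : Fin 2 → ℝ) (k : Plane) : L2Cell a →ₗ.[ℂ] L2Cell a :=
  (pointScattererGraph a α k).toLinearPMap

end HoneycombPointScatterer

end

open MeasureTheory Filter Topology

noncomputable section

namespace HoneycombPointScatterer

/-! ### Abel summation over growing discs -/

section Abel

lemma hasDerivAt_neg_inv_sq_add_one (t : ℝ) :
    HasDerivAt (fun t : ℝ => -(t ^ 2 + 1)⁻¹) (2 * t / (t ^ 2 + 1) ^ 2) t := by
  have h : HasDerivAt (fun t : ℝ => t ^ 2 + 1) (2 * t) t := by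
    simpa using (hasDerivAt_pow 2 t).add_const (1 : ℝ)
  have h2 := (h.inv (by positivity)).neg
  exact h2.congr_deriv (by ring)

lemma continuous_abelWeight : Continuous fun t : ℝ => 2 * t / (t ^ 2 + 1) ^ 2 :=
  (by fun_prop : Continuous fun t : ℝ => 2 * t).div (by fun_prop) fun t => by positivity

lemma integral_abelWeight (s r : ℝ) :
    ∫ t in s..r, 2 * t / (t ^ 2 + 1) ^ 2 = (s ^ 2 + 1)⁻¹ - (r ^ 2 + 1)⁻¹ := by
  rw [intervalIntegral.integral_eq_sub_of_hasDerivAt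
    (fun t _ => hasDerivAt_neg_inv_sq_add_one t) (continuous_abelWeight.intervalIntegrable _ _)]
  ring

lemma integral_abelWeight_mul_sq (r : ℝ) :
    ∫ t in (0 : ℝ)..r, 2 * t / (t ^ 2 + 1) ^ 2 * t ^ 2 =
      Real.log (r ^ 2 + 1) + (r ^ 2 + 1)⁻¹ - 1 := by
  have hd : ∀ t : ℝ, HasDerivAt (fun t : ℝ => Real.log (t ^ 2 + 1) - -(t ^ 2 + 1)⁻¹)
      (2 * t / (t ^ 2 + 1) ^ 2 * t ^ 2) t := by
    intro t
    have h : HasDerivAt (fun t : ℝ => t ^ 2 + 1) (2 * t) t := by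
      simpa using (hasDerivAt_pow 2 t).add_const (1 : ℝ)
    have hp : t ^ 2 + 1 ≠ 0 := by positivity
    have h2 := (h.log hp).sub (hasDerivAt_neg_inv_sq_add_one t)
    refine h2.congr_deriv ?_
    field_simp
    ring
  rw [intervalIntegral.integral_eq_sub_of_hasDerivAt (fun t _ => hd t)
    ((continuous_abelWeight.mul (by fun_prop)).intervalIntegrable _ _)]
  norm_num

variable {ι : Type*} (ρ : ι → ℝ) (D : ℝ → Finset ι) (b : ι → ℂ)

lemma sum_eq_sum_indicator (hD : ∀ i r, i ∈ D r ↔ ρ i ≤ r) {t r : ℝ} (htr : t ≤ r) :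
    ∑ i ∈ D t, b i = ∑ i ∈ D r, (Set.Ici (ρ i)).indicator (fun _ => b i) t := by
  classical
  have : D t = (D r).filter fun i => ρ i ≤ t := by
    ext i
    simp only [hD, Finset.mem_filter]
    exact ⟨fun h => ⟨h.trans htr, h⟩, fun h => h.2⟩
  rw [this, Finset.sum_filter]
  refine Finset.sum_congr rfl fun i _ => ?_
  simp [Set.indicator_apply]

lemma sum_div_eq_integral (hρ : ∀ i, 0 ≤ ρ i) (hD : ∀ i r, i ∈ D r ↔ ρ i ≤ r) {r : ℝ}
    (hr : 0 ≤ r) :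
    IntervalIntegrable (fun t : ℝ => ((2 * t / (t ^ 2 + 1) ^ 2 : ℝ) : ℂ) * ∑ i ∈ D t, b i)
      volume 0 r ∧
    ∑ i ∈ D r, b i / ((ρ i ^ 2 + 1 : ℝ) : ℂ) =
      (∑ i ∈ D r, b i) / ((r ^ 2 + 1 : ℝ) : ℂ) +
      ∫ t in (0 : ℝ)..r, ((2 * t / (t ^ 2 + 1) ^ 2 : ℝ) : ℂ) * ∑ i ∈ D t, b i := by
  have hw : Continuous fun t : ℝ => ((2 * t / (t ^ 2 + 1) ^ 2 : ℝ) : ℂ) :=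
    Complex.continuous_ofReal.comp continuous_abelWeight
  have hEq : Set.EqOn
      (fun t => ∑ i ∈ D r, (Set.Ici (ρ i)).indicator
        (fun t : ℝ => ((2 * t / (t ^ 2 + 1) ^ 2 : ℝ) : ℂ) * b i) t)
      (fun t : ℝ => ((2 * t / (t ^ 2 + 1) ^ 2 : ℝ) : ℂ) * ∑ i ∈ D t, b i) (Set.uIcc 0 r) := by
    intro t ht
    rw [Set.uIcc_of_le hr] at ht
    simp only
    rw [sum_eq_sum_indicator ρ D b hD ht.2, Finset.mul_sum]
    refine Finset.sum_congr rfl fun i _ => ?_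
    by_cases h : t ∈ Set.Ici (ρ i) <;> simp [h]
  have hint : ∀ i, IntervalIntegrable ((Set.Ici (ρ i)).indicator
        (fun t : ℝ => ((2 * t / (t ^ 2 + 1) ^ 2 : ℝ) : ℂ) * b i)) volume 0 r := by
    intro i
    have h : Continuous fun t : ℝ => ((2 * t / (t ^ 2 + 1) ^ 2 : ℝ) : ℂ) * b i :=
      hw.mul continuous_const
    rw [intervalIntegrable_iff_integrableOn_Ioc_of_le hr]
    exact (h.intervalIntegrable (μ := volume) 0 r).1.indicator (measurableSet_Ici (a := ρ i))
  have hterm : ∀ i ∈ D r, ∫ t in (0 : ℝ)..r, (Set.Ici (ρ i)).indicator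
        (fun t : ℝ => ((2 * t / (t ^ 2 + 1) ^ 2 : ℝ) : ℂ) * b i) t =
      b i / ((ρ i ^ 2 + 1 : ℝ) : ℂ) - b i / ((r ^ 2 + 1 : ℝ) : ℂ) := by
    intro i hi
    have hir := (hD i r).1 hi
    rw [intervalIntegral.integral_of_le hr, setIntegral_indicator measurableSet_Ici]
    have hset : (Set.Ioc 0 r ∩ Set.Ici (ρ i) : Set ℝ) =ᵐ[volume] Set.Ioc (ρ i) r := by
      have h1 : (Set.Ioc (ρ i) r : Set ℝ) =ᵐ[volume] Set.Icc (ρ i) r := Ioc_ae_eq_Icc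
      have h2 : (Set.Ioc 0 r ∩ Set.Ici (ρ i) : Set ℝ) =ᵐ[volume]
          (Set.Icc 0 r ∩ Set.Ici (ρ i) : Set ℝ) := Ioc_ae_eq_Icc.inter (ae_eq_refl _)
      refine h2.trans (EventuallyEq.trans ?_ h1.symm)
      refine (Set.ext fun t => ?_ : (Set.Icc 0 r ∩ Set.Ici (ρ i) : Set ℝ) = _).eventuallyEq
      simp only [Set.mem_inter_iff, Set.mem_Icc, Set.mem_Ici]
      exact ⟨fun h => ⟨h.2, h.1.2⟩, fun h => ⟨⟨(hρ i).trans h.1, h.2⟩, h.1⟩⟩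
    rw [setIntegral_congr_set hset, ← intervalIntegral.integral_of_le hir,
      intervalIntegral.integral_mul_const, intervalIntegral.integral_ofReal, integral_abelWeight]
    push_cast
    ring
  have hsum : IntervalIntegrable (fun t => ∑ i ∈ D r, (Set.Ici (ρ i)).indicator
        (fun t : ℝ => ((2 * t / (t ^ 2 + 1) ^ 2 : ℝ) : ℂ) * b i) t) volume 0 r := by
    have := IntervalIntegrable.sum (μ := volume) (a := 0) (b := r) (D r) (fun i _ => hint i)
    refine this.congr (fun t _ => ?_)
    simp
  refine ⟨hsum.congr (hEq.mono Set.uIoc_subset_uIcc), ?_⟩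
  rw [← intervalIntegral.integral_congr hEq,
    intervalIntegral.integral_finsetSum fun i _ => hint i, Finset.sum_congr rfl hterm,
    Finset.sum_sub_distrib, Finset.sum_div]
  ring

/-- If the partial sums `∑_{ρ_i ≤ t} b_i` equal `c t² + O(1 + t)`, then the weighted sums
`∑_{ρ_i ≤ r} b_i / (ρ_i² + 1) - 2 c log r` converge. -/
theorem exists_tendsto_sum_div (hρ : ∀ i, 0 ≤ ρ i) (hD : ∀ i r, i ∈ D r ↔ ρ i ≤ r) (c C : ℝ)
    (hS : ∀ t, 0 ≤ t → ‖∑ i ∈ D t, b i - ((c * t ^ 2 : ℝ) : ℂ)‖ ≤ C * (1 + t)) :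
    ∃ L : ℂ, Tendsto (fun r : ℝ => ∑ i ∈ D r, b i / ((ρ i ^ 2 + 1 : ℝ) : ℂ) -
      ((2 * c * Real.log r : ℝ) : ℂ)) atTop (𝓝 L) := by
  have hC : 0 ≤ C := by
    have := (norm_nonneg _).trans (hS 0 le_rfl)
    simpa using this
  set E : ℝ → ℂ := fun t => ∑ i ∈ D t, b i - ((c * t ^ 2 : ℝ) : ℂ) with hE
  set w : ℝ → ℝ := fun t => 2 * t / (t ^ 2 + 1) ^ 2 with hw
  have hwE_int : ∀ r, 0 ≤ r → IntervalIntegrable (fun t => (w t : ℂ) * E t) volume 0 r := by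
    intro r hr
    have h1 := (sum_div_eq_integral ρ D b hρ hD hr).1
    have h2 : IntervalIntegrable (fun t : ℝ => (w t : ℂ) * ((c * t ^ 2 : ℝ) : ℂ)) volume 0 r :=
      Continuous.intervalIntegrable
        ((Complex.continuous_ofReal.comp continuous_abelWeight).mul (by fun_prop)) _ _
    refine (h1.sub h2).congr (fun t _ => ?_)
    simp only [hE, hw]
    ring
  have hbound : ∀ t, 0 ≤ t → ‖(w t : ℂ) * E t‖ ≤ 3 * C * (1 + t ^ 2)⁻¹ := by
    intro t ht
    have hw0 : 0 ≤ w t := by simp only [hw]; positivity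
    rw [norm_mul, Complex.norm_real, Real.norm_of_nonneg hw0]
    refine (mul_le_mul_of_nonneg_left (hS t ht) hw0).trans ?_
    simp only [hw]
    rw [div_mul_eq_mul_div, div_le_iff₀ (by positivity)]
    have : 3 * C * (1 + t ^ 2)⁻¹ * (t ^ 2 + 1) ^ 2 = C * (3 * (1 + t ^ 2)) := by
      field_simp
      ring
    rw [this]
    have h2 : 2 * t * (1 + t) ≤ 3 * (1 + t ^ 2) := by nlinarith [sq_nonneg (t - 1)]
    nlinarith [mul_le_mul_of_nonneg_left h2 hC]
  have hmeas : AEStronglyMeasurable (fun t => (w t : ℂ) * E t)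
      (volume.restrict (Set.Ioi (0 : ℝ))) := by
    have hU : Set.Ioi (0 : ℝ) = ⋃ n : ℕ, Set.Ioc (0 : ℝ) n := by
      ext t
      simp only [Set.mem_Ioi, Set.mem_iUnion, Set.mem_Ioc]
      exact ⟨fun h => (exists_nat_ge t).imp fun n hn => ⟨h, hn⟩, fun ⟨_, h⟩ => h.1⟩
    rw [hU, aestronglyMeasurable_iUnion_iff]
    intro n
    exact ((intervalIntegrable_iff_integrableOn_Ioc_of_le (Nat.cast_nonneg n)).1
      (hwE_int n (Nat.cast_nonneg n))).aestronglyMeasurable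
  have hintegrable : IntegrableOn (fun t => (w t : ℂ) * E t) (Set.Ioi 0) := by
    refine Integrable.mono' ((integrable_inv_one_add_sq.const_mul (3 * C)).integrableOn) hmeas ?_
    filter_upwards [ae_restrict_mem measurableSet_Ioi] with t ht
    exact hbound t (le_of_lt ht)
  have hlim1 := intervalIntegral_tendsto_integral_Ioi 0 hintegrable tendsto_id
  have hlim2 : Tendsto (fun r : ℝ => E r / ((r ^ 2 + 1 : ℝ) : ℂ)) atTop (𝓝 0) := by
    have h0 : Tendsto (fun r : ℝ => 2 * C * r⁻¹) atTop (𝓝 0) := by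
      simpa using tendsto_inv_atTop_zero.const_mul (2 * C)
    refine squeeze_zero_norm' ?_ h0
    filter_upwards [eventually_ge_atTop 1] with r hr
    have hr0 : (0 : ℝ) < r := by linarith
    rw [norm_div, Complex.norm_real, Real.norm_of_nonneg (by positivity), div_le_iff₀ (by positivity)]
    refine (hS r hr0.le).trans ?_
    have : 2 * C * r⁻¹ * (r ^ 2 + 1) = C * (2 * r + 2 * r⁻¹) := by field_simp
    rw [this]
    refine mul_le_mul_of_nonneg_left ?_ hC
    have : 0 ≤ r⁻¹ := by positivity
    linarith
  have hlim3 : Tendsto (fun r : ℝ => Real.log (r ^ 2 + 1) - 2 * Real.log r) atTop (𝓝 0) := by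
    have h1 : Tendsto (fun r : ℝ => Real.log (1 + (r ^ 2)⁻¹)) atTop (𝓝 0) := by
      have h2 : Tendsto (fun r : ℝ => 1 + (r ^ 2)⁻¹) atTop (𝓝 1) := by
        simpa using (tendsto_inv_atTop_zero.comp (tendsto_pow_atTop two_ne_zero)).const_add (1 : ℝ)
      have h3 := (Real.continuousAt_log one_ne_zero).tendsto.comp h2
      rwa [Real.log_one] at h3
    refine h1.congr' ?_
    filter_upwards [eventually_gt_atTop 0] with r hr
    have : 1 + (r ^ 2)⁻¹ = (r ^ 2 + 1) / r ^ 2 := by field_simp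
    rw [this, Real.log_div (by positivity) (by positivity), Real.log_pow]
    norm_num
  refine ⟨_, ((hlim2.add hlim1).add
    ((Complex.continuous_ofReal.tendsto _).comp (hlim3.const_mul c))).congr' ?_⟩
  filter_upwards [eventually_gt_atTop 0] with r hr
  rw [(sum_div_eq_integral ρ D b hρ hD hr.le).2]
  have hsplit : ∫ t in (0 : ℝ)..r, ((2 * t / (t ^ 2 + 1) ^ 2 : ℝ) : ℂ) * ∑ i ∈ D t, b i =
      (∫ t in (0 : ℝ)..r, (w t : ℂ) * E t) +
        ((c * (Real.log (r ^ 2 + 1) + (r ^ 2 + 1)⁻¹ - 1) : ℝ) : ℂ) := by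
    rw [← integral_abelWeight_mul_sq, ← intervalIntegral.integral_const_mul,
      ← intervalIntegral.integral_ofReal, ← intervalIntegral.integral_add (hwE_int r hr.le)]
    · refine intervalIntegral.integral_congr fun t _ => ?_
      simp only [hE, hw]
      push_cast
      ring
    · exact Continuous.intervalIntegrable (Complex.continuous_ofReal.comp
        (continuous_const.mul (continuous_abelWeight.mul (by fun_prop)))) _ _
  rw [hsplit]
  have hp : ((r : ℂ) ^ 2 + 1) ≠ 0 := by
    have : (r ^ 2 + 1 : ℝ) ≠ 0 := by positivity
    exact_mod_cast this
  simp only [hE, Function.comp_apply, id_eq]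
  push_cast
  field_simp
  ring

end Abel

/-! ### Geometry of the two lattices -/

section Geometry

lemma inner_plane (x y : Plane) : inner ℝ x y = x 0 * y 0 + x 1 * y 1 := by
  rw [PiLp.inner_apply, Fin.sum_univ_two]
  simp [mul_comm]

variable {a : ℝ}

lemma inner_k₁_v₁ (ha : 0 < a) : inner ℝ (k₁ a) (v₁ a) = 2 * Real.pi := by
  have h3 : √3 * √3 = 3 := Real.mul_self_sqrt (by norm_num)
  have h0 : √3 ≠ 0 := by positivity
  simp only [inner_plane, k₁, v₁, PiLp.smul_apply, smul_eq_mul]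
  simp
  field_simp
  nlinarith

lemma inner_k₂_v₂ (ha : 0 < a) : inner ℝ (k₂ a) (v₂ a) = 2 * Real.pi := by
  have h0 : √3 ≠ 0 := by positivity
  simp only [inner_plane, k₂, v₂, PiLp.smul_apply, smul_eq_mul]
  simp
  field_simp
  ring

lemma inner_k₁_v₂ : inner ℝ (k₁ a) (v₂ a) = 0 := by
  simp only [inner_plane, k₁, v₂, PiLp.smul_apply, smul_eq_mul]
  simp
  ring

lemma inner_k₂_v₁ : inner ℝ (k₂ a) (v₁ a) = 0 := by
  simp only [inner_plane, k₂, v₁, PiLp.smul_apply, smul_eq_mul]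
  simp
  ring

lemma areaCell_pos (ha : 0 < a) : 0 < areaCell a := by unfold areaCell; positivity

lemma areaBrillouin_pos (ha : 0 < a) : 0 < areaBrillouin a :=
  div_pos (by positivity) (areaCell_pos ha)

lemma inner_v₁_dualVec (ha : 0 < a) (m : ℤ × ℤ) :
    inner ℝ (v₁ a) (dualVec a m) = 2 * Real.pi * m.1 := by
  rw [dualVec, inner_add_right, inner_smul_right, inner_smul_right, real_inner_comm,
    inner_k₁_v₁ ha, real_inner_comm, inner_k₂_v₁]
  ring

lemma inner_v₂_dualVec (ha : 0 < a) (m : ℤ × ℤ) :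
    inner ℝ (v₂ a) (dualVec a m) = 2 * Real.pi * m.2 := by
  rw [dualVec, inner_add_right, inner_smul_right, inner_smul_right, real_inner_comm,
    inner_k₁_v₂, real_inner_comm, inner_k₂_v₂ ha]
  ring

lemma inner_k₁_x₀ (ha : 0 < a) : inner ℝ (k₁ a) (x₀ a) = 4 * Real.pi / 3 := by
  rw [x₀, inner_smul_right, inner_add_right, inner_k₁_v₁ ha, inner_k₁_v₂]
  ring

lemma inner_k₁_of_mem_triangularLattice (ha : 0 < a) {x : Plane} (hx : x ∈ triangularLattice a) :
    ∃ n : ℤ, inner ℝ (k₁ a) x = 2 * Real.pi * n := by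
  obtain ⟨m, rfl⟩ := hx
  refine ⟨m.1, ?_⟩
  simp only [inner_add_right, inner_smul_right, inner_k₁_v₁ ha, inner_k₁_v₂]
  ring

lemma zero_mem_triangularLattice : (0 : Plane) ∈ triangularLattice a := ⟨0, by simp⟩

lemma neg_mem_triangularLattice {x : Plane} (hx : x ∈ triangularLattice a) :
    -x ∈ triangularLattice a := by
  obtain ⟨m, rfl⟩ := hx
  refine ⟨-m, ?_⟩
  simp only [Prod.fst_neg, Prod.snd_neg, Int.cast_neg, neg_smul, neg_add]

lemma x₀_notMem_triangularLattice (ha : 0 < a) : x₀ a ∉ triangularLattice a := by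
  intro h
  obtain ⟨n, hn⟩ := inner_k₁_of_mem_triangularLattice ha h
  rw [inner_k₁_x₀ ha] at hn
  have h1 : Real.pi * (2 - 3 * n : ℝ) = 0 := by linarith
  have h2 : (2 - 3 * n : ℝ) = 0 := by simpa [Real.pi_ne_zero] using h1
  have h3 : (2 - 3 * n : ℤ) = 0 := by exact_mod_cast h2
  omega

lemma neg_x₀_notMem_triangularLattice (ha : 0 < a) : -x₀ a ∉ triangularLattice a := fun h =>
  x₀_notMem_triangularLattice ha (by simpa using neg_mem_triangularLattice h)

lemma exists_abs_le_norm_dualVec_add (ha : 0 < a) (k : Plane) :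
    ∃ K : ℝ, 0 < K ∧ ∀ m : ℤ × ℤ,
      |(m.1 : ℝ)| ≤ K * (1 + ‖dualVec a m + k‖) ∧ |(m.2 : ℝ)| ≤ K * (1 + ‖dualVec a m + k‖) := by
  have key : ∀ (v : Plane) (j : ℝ) (ξ : Plane), inner ℝ v ξ = 2 * Real.pi * j →
      |j| ≤ ‖v‖ * (1 + ‖k‖) * (1 + ‖ξ + k‖) := by
    intro v j ξ h
    have h1 : |2 * Real.pi * j| ≤ ‖v‖ * ‖ξ‖ := h ▸ abs_real_inner_le_norm v ξ
    rw [abs_mul, abs_of_pos Real.two_pi_pos] at h1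
    have h2 : |j| ≤ 2 * Real.pi * |j| := by
      nlinarith [abs_nonneg j, Real.pi_gt_three]
    have h3 : ‖ξ‖ ≤ ‖ξ + k‖ + ‖k‖ := by simpa using norm_sub_le (ξ + k) k
    have h4 : ‖ξ‖ ≤ (1 + ‖k‖) * (1 + ‖ξ + k‖) := by
      nlinarith [norm_nonneg k, norm_nonneg (ξ + k)]
    calc |j| ≤ ‖v‖ * ‖ξ‖ := h2.trans h1
      _ ≤ ‖v‖ * ((1 + ‖k‖) * (1 + ‖ξ + k‖)) := by gcongr
      _ = _ := by ring
  refine ⟨(‖v₁ a‖ + ‖v₂ a‖ + 1) * (1 + ‖k‖), by positivity, fun m => ⟨?_, ?_⟩⟩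
  · refine (key _ _ _ (inner_v₁_dualVec ha m)).trans ?_
    gcongr
    linarith [norm_nonneg (v₂ a)]
  · refine (key _ _ _ (inner_v₂_dualVec ha m)).trans ?_
    gcongr
    linarith [norm_nonneg (v₁ a)]

lemma finite_norm_dualVec_add_le (ha : 0 < a) (k : Plane) (r : ℝ) :
    {m : ℤ × ℤ | ‖dualVec a m + k‖ ≤ r}.Finite := by
  obtain ⟨K, hK, h⟩ := exists_abs_le_norm_dualVec_add ha k
  refine ((Set.finite_Icc (-⌈K * (1 + r)⌉) ⌈K * (1 + r)⌉).prod
    (Set.finite_Icc (-⌈K * (1 + r)⌉) ⌈K * (1 + r)⌉)).subset fun m hm => ?_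
  have hle : K * (1 + ‖dualVec a m + k‖) ≤ K * (1 + r) := by
    have : ‖dualVec a m + k‖ ≤ r := hm
    gcongr
  have key : ∀ j : ℤ, |(j : ℝ)| ≤ K * (1 + ‖dualVec a m + k‖) →
      j ∈ Set.Icc (-⌈K * (1 + r)⌉) ⌈K * (1 + r)⌉ := by
    intro j hj
    have h1 : |(j : ℝ)| ≤ ⌈K * (1 + r)⌉ := (hj.trans hle).trans (Int.le_ceil _)
    rw [abs_le] at h1
    exact ⟨by exact_mod_cast h1.1, by exact_mod_cast h1.2⟩
  exact ⟨key _ (h m).1, key _ (h m).2⟩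

/-- The indices `m` with `|ξ_m + k| ≤ r`. -/
def dualDisc (ha : 0 < a) (k : Plane) (r : ℝ) : Finset (ℤ × ℤ) :=
  (finite_norm_dualVec_add_le ha k r).toFinset

lemma mem_dualDisc (ha : 0 < a) (k : Plane) (m : ℤ × ℤ) (r : ℝ) :
    m ∈ dualDisc ha k r ↔ ‖dualVec a m + k‖ ≤ r := by
  simp [dualDisc]

lemma tendsto_dualDisc (ha : 0 < a) (k : Plane) : Tendsto (dualDisc ha k) atTop atTop := by
  refine tendsto_atTop_finset_of_monotone (fun r s hrs m hm => ?_) fun m =>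
    ⟨‖dualVec a m + k‖, (mem_dualDisc ha k m _).2 le_rfl⟩
  rw [mem_dualDisc] at hm ⊢
  exact hm.trans hrs

lemma summable_inv_sq_add_one_sq (ha : 0 < a) (k : Plane) :
    Summable fun m : ℤ × ℤ => ((‖dualVec a m + k‖ ^ 2 + 1) ^ 2)⁻¹ := by
  obtain ⟨K, hK, h⟩ := exists_abs_le_norm_dualVec_add ha k
  have hs := (EisensteinSeries.summable_one_div_norm_rpow (k := 4) (by norm_num)).mul_left
    (4 * K ^ 4)
  rw [← (finTwoArrowEquiv ℤ).symm.summable_iff] at hs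
  refine Summable.of_norm_bounded_eventually hs ?_
  filter_upwards [(Set.finite_singleton (0 : ℤ × ℤ)).compl_mem_cofinite] with m hm
  set R := ‖dualVec a m + k‖ with hR
  have hR0 : 0 ≤ R := norm_nonneg _
  set N := ‖(finTwoArrowEquiv ℤ).symm m‖ with hN
  have hle : N ≤ K * (1 + R) := by
    refine (pi_norm_le_iff_of_nonneg (by positivity)).2 fun i => ?_
    fin_cases i
    · simpa [Int.norm_eq_abs] using (h m).1
    · simpa [Int.norm_eq_abs] using (h m).2
  have hpos : 0 < N := by
    refine norm_pos_iff.2 fun h0 => hm ?_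
    have := (finTwoArrowEquiv ℤ).symm.injective (a₁ := m) (a₂ := 0)
      (h0.trans (by ext i; fin_cases i <;> rfl))
    exact this
  have hbd : N ^ 4 ≤ 4 * K ^ 4 * (R ^ 2 + 1) ^ 2 := by
    have h1 : N ^ 2 ≤ 2 * K ^ 2 * (R ^ 2 + 1) := by
      calc N ^ 2 ≤ (K * (1 + R)) ^ 2 := by gcongr
        _ = K ^ 2 * (1 + R) ^ 2 := by ring
        _ ≤ K ^ 2 * (2 * (R ^ 2 + 1)) := by
          gcongr
          nlinarith [sq_nonneg (R - 1)]
        _ = _ := by ring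
    calc N ^ 4 = (N ^ 2) ^ 2 := by ring
      _ ≤ (2 * K ^ 2 * (R ^ 2 + 1)) ^ 2 := by gcongr
      _ = _ := by ring
  rw [Real.norm_of_nonneg (by positivity)]
  simp only [Function.comp_apply]
  rw [← hN, Real.rpow_neg hpos.le, show (4 : ℝ) = ((4 : ℕ) : ℝ) by norm_num, Real.rpow_natCast,
    ← div_eq_mul_inv, inv_eq_one_div, div_le_div_iff₀ (by positivity) (by positivity)]
  push_cast
  linarith

/-- The linear map sending the standard basis of the plane to `u, w`. -/
def planeMap (u w : Plane) : Plane →L[ℝ] Plane :=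
  (EuclideanSpace.proj (0 : Fin 2)).smulRight u + (EuclideanSpace.proj (1 : Fin 2)).smulRight w

lemma planeMap_apply (u w x : Plane) : planeMap u w x = x 0 • u + x 1 • w := rfl

lemma det_planeMap (u w : Plane) :
    LinearMap.det (planeMap u w : Plane →ₗ[ℝ] Plane) = u 0 * w 1 - u 1 * w 0 := by
  rw [← LinearMap.det_toMatrix (EuclideanSpace.basisFun (Fin 2) ℝ).toBasis, Matrix.det_fin_two]
  simp [LinearMap.toMatrix_apply, planeMap_apply]
  ring

lemma det_planeMap_v (a : ℝ) :
    LinearMap.det (planeMap (v₁ a) (v₂ a) : Plane →ₗ[ℝ] Plane) = -areaCell a := by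
  rw [det_planeMap]
  simp [v₁, v₂, areaCell]
  ring

lemma det_planeMap_k (ha : 0 < a) :
    LinearMap.det (planeMap (k₁ a) (k₂ a) : Plane →ₗ[ℝ] Plane) = -areaBrillouin a := by
  have h3 : √3 * √3 = 3 := Real.mul_self_sqrt (by norm_num)
  have h0 : √3 ≠ 0 := by positivity
  rw [det_planeMap]
  simp [k₁, k₂, areaBrillouin, areaCell]
  field_simp
  nlinarith

/-- The half-open unit square with lower left corner `m`. -/
def unitSquare (m : ℤ × ℤ) : Set Plane := {x | ⌊x 0⌋ = m.1 ∧ ⌊x 1⌋ = m.2}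

lemma unitSquare_eq_preimage (m : ℤ × ℤ) : unitSquare m = WithLp.ofLp ⁻¹'
    (Set.univ.pi fun i : Fin 2 => Set.Ico ((![m.1, m.2] i : ℤ) : ℝ) ((![m.1, m.2] i : ℤ) + 1)) := by
  ext x
  simp [unitSquare, Int.floor_eq_iff]

lemma measurableSet_unitSquare (m : ℤ × ℤ) : MeasurableSet (unitSquare m) := by
  rw [unitSquare_eq_preimage]
  exact (PiLp.volume_preserving_ofLp (Fin 2)).measurable
    (MeasurableSet.univ_pi fun _ => measurableSet_Ico)

lemma volume_unitSquare (m : ℤ × ℤ) : volume (unitSquare m) = 1 := by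
  rw [unitSquare_eq_preimage, (PiLp.volume_preserving_ofLp (Fin 2)).measure_preimage
    (MeasurableSet.univ_pi fun _ => measurableSet_Ico).nullMeasurableSet, Real.volume_pi_Ico]
  simp

lemma volume_planeMap_add_le (ha : 0 < a) (k : Plane) {r : ℝ} (hr : 0 ≤ r) :
    volume {x : Plane | ‖planeMap (k₁ a) (k₂ a) x + k‖ ≤ r} =
      ENNReal.ofReal (Real.pi / areaBrillouin a * r ^ 2) := by
  have hB := areaBrillouin_pos ha
  have hset : {x : Plane | ‖planeMap (k₁ a) (k₂ a) x + k‖ ≤ r} =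
      (planeMap (k₁ a) (k₂ a) : Plane →ₗ[ℝ] Plane) ⁻¹' Metric.closedBall (-k) r := by
    ext x
    simp [dist_eq_norm]
  rw [hset, Measure.addHaar_preimage_linearMap volume
    (by rw [det_planeMap_k ha]; exact neg_ne_zero.2 hB.ne'), det_planeMap_k ha,
    EuclideanSpace.volume_closedBall_fin_two, abs_inv, abs_neg, abs_of_pos hB,
    ← ENNReal.ofReal_pow hr]
  rw [← ENNReal.ofReal_mul (by positivity), ← ENNReal.ofReal_mul (by positivity)]
  congr 1
  ring

lemma norm_planeMap_sub_dualVec_le {m : ℤ × ℤ} {x : Plane} (hx : x ∈ unitSquare m) :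
    ‖planeMap (k₁ a) (k₂ a) x - dualVec a m‖ ≤ ‖k₁ a‖ + ‖k₂ a‖ := by
  have h : planeMap (k₁ a) (k₂ a) x - dualVec a m =
      Int.fract (x 0) • k₁ a + Int.fract (x 1) • k₂ a := by
    rw [planeMap_apply, dualVec, ← hx.1, ← hx.2, Int.fract, Int.fract]
    module
  have hf : ∀ t : ℝ, ‖Int.fract t‖ ≤ 1 := fun t => by
    rw [Real.norm_of_nonneg (Int.fract_nonneg t)]
    exact (Int.fract_lt_one t).le
  rw [h]
  refine (norm_add_le _ _).trans (add_le_add ?_ ?_) <;> rw [norm_smul] <;>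
    exact mul_le_of_le_one_left (norm_nonneg _) (hf _)

/-- The number of dual lattice points in a disc of radius `t` is its area divided by
`area(𝓑)`, up to `O(1 + t)`. -/
theorem exists_abs_card_dualDisc_sub_le (ha : 0 < a) (k : Plane) :
    ∃ C : ℝ, ∀ t, 0 ≤ t →
      |((dualDisc ha k t).card : ℝ) - Real.pi / areaBrillouin a * t ^ 2| ≤ C * (1 + t) := by
  have hB := areaBrillouin_pos ha
  set c := Real.pi / areaBrillouin a with hc
  have hc0 : 0 ≤ c := by positivity
  set d := ‖k₁ a‖ + ‖k₂ a‖ with hd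
  have hd0 : 0 ≤ d := by positivity
  refine ⟨c * (2 * d + d ^ 2), fun t ht => ?_⟩
  have hvol : volume (⋃ m ∈ dualDisc ha k t, unitSquare m) = (dualDisc ha k t).card := by
    rw [measure_biUnion_finset _ fun m _ => measurableSet_unitSquare m]
    · simp [volume_unitSquare]
    · intro m _ n _ hmn
      refine Set.disjoint_left.2 fun x hx hy => hmn ?_
      exact Prod.ext (hx.1.symm.trans hy.1) (hx.2.symm.trans hy.2)
  have hupper : ((dualDisc ha k t).card : ℝ) ≤ c * (t + d) ^ 2 := by
    have hsub : (⋃ m ∈ dualDisc ha k t, unitSquare m) ⊆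
        {x : Plane | ‖planeMap (k₁ a) (k₂ a) x + k‖ ≤ t + d} := by
      intro x hx
      simp only [Set.mem_iUnion, mem_dualDisc] at hx
      obtain ⟨m, hm, hx⟩ := hx
      have := norm_add_le (dualVec a m + k) (planeMap (k₁ a) (k₂ a) x - dualVec a m)
      rw [show dualVec a m + k + (planeMap (k₁ a) (k₂ a) x - dualVec a m) =
        planeMap (k₁ a) (k₂ a) x + k by abel] at this
      exact this.trans (add_le_add hm (norm_planeMap_sub_dualVec_le hx))
    have := measure_mono (μ := volume) hsub
    rw [hvol, volume_planeMap_add_le ha k (by positivity), ← ENNReal.ofReal_natCast,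
      ENNReal.ofReal_le_ofReal_iff (by positivity)] at this
    exact this
  have hlower : c * t ^ 2 - c * (2 * d) * t ≤ ((dualDisc ha k t).card : ℝ) := by
    rcases lt_or_ge t d with htd | htd
    · have h1 : c * t ^ 2 - c * (2 * d) * t ≤ 0 := by
        have : t * (t - 2 * d) ≤ 0 := mul_nonpos_of_nonneg_of_nonpos ht (by linarith)
        nlinarith
      exact h1.trans (Nat.cast_nonneg _)
    · have hsub : {x : Plane | ‖planeMap (k₁ a) (k₂ a) x + k‖ ≤ t - d} ⊆
          (⋃ m ∈ dualDisc ha k t, unitSquare m) := by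
        intro x hx
        simp only [Set.mem_iUnion, mem_dualDisc]
        have hxm : x ∈ unitSquare (⌊x 0⌋, ⌊x 1⌋) := ⟨rfl, rfl⟩
        refine ⟨(⌊x 0⌋, ⌊x 1⌋), ?_, hxm⟩
        have := norm_sub_le (planeMap (k₁ a) (k₂ a) x + k)
          (planeMap (k₁ a) (k₂ a) x - dualVec a (⌊x 0⌋, ⌊x 1⌋))
        rw [add_sub_sub_cancel, add_comm k] at this
        have h1 := norm_planeMap_sub_dualVec_le (a := a) hxm
        have h2 : ‖planeMap (k₁ a) (k₂ a) x + k‖ ≤ t - d := hx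
        linarith
      have := measure_mono (μ := volume) hsub
      rw [hvol, volume_planeMap_add_le ha k (by linarith), ← ENNReal.ofReal_natCast,
        ENNReal.ofReal_le_ofReal_iff (Nat.cast_nonneg _)] at this
      nlinarith [mul_nonneg hc0 (sq_nonneg d)]
  rw [abs_le]
  have h1 : 0 ≤ c * d ^ 2 := by positivity
  have h2 : 0 ≤ c * (2 * d) := by positivity
  have h3 := mul_nonneg h1 ht
  constructor <;> nlinarith

lemma norm_planeWave (ξ x : Plane) : ‖planeWave ξ x‖ = 1 := by
  rw [planeWave, mul_comm, Complex.norm_exp_ofReal_mul_I]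

lemma planeWave_add_left (ξ η x : Plane) :
    planeWave (ξ + η) x = planeWave ξ x * planeWave η x := by
  simp only [planeWave, inner_add_left, Complex.ofReal_add, mul_add, Complex.exp_add]

lemma planeWave_add_right (ξ x y : Plane) :
    planeWave ξ (x + y) = planeWave ξ x * planeWave ξ y := by
  simp only [planeWave, inner_add_right, Complex.ofReal_add, mul_add, Complex.exp_add]

lemma conj_planeWave (ξ x : Plane) : starRingEnd ℂ (planeWave ξ x) = planeWave ξ (-x) := by
  simp only [planeWave, ← Complex.exp_conj, map_mul, Complex.conj_I, Complex.conj_ofReal,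
    inner_neg_right, Complex.ofReal_neg]
  congr 1
  ring

lemma planeWave_zero_right (ξ : Plane) : planeWave ξ 0 = 1 := by simp [planeWave]

lemma planeWave_eq_one_iff (ξ x : Plane) :
    planeWave ξ x = 1 ↔ ∃ n : ℤ, inner ℝ ξ x = 2 * Real.pi * n := by
  rw [planeWave, Complex.exp_eq_one_iff]
  refine exists_congr fun n => ?_
  rw [show (n : ℂ) * (2 * Real.pi * Complex.I) = Complex.I * ((2 * Real.pi * n : ℝ) : ℂ) by
    push_cast; ring]
  rw [mul_right_inj' Complex.I_ne_zero, Complex.ofReal_inj]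

/-- The exponential sums over discs are `O(1 + t)` if `e^{i k₁·x} ≠ 1`. -/
theorem exists_norm_sum_planeWave_le (ha : 0 < a) (k : Plane) {x : Plane}
    (hx : planeWave (k₁ a) x ≠ 1) :
    ∃ C : ℝ, ∀ t, 0 ≤ t →
      ‖∑ m ∈ dualDisc ha k t, planeWave (dualVec a m + k) x‖ ≤ C * (1 + t) := by
  classical
  obtain ⟨C, hC⟩ := exists_abs_card_dualDisc_sub_le ha k
  set c := Real.pi / areaBrillouin a with hc
  have hc0 : 0 ≤ c := div_nonneg Real.pi_pos.le (areaBrillouin_pos ha).le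
  set d := ‖k₁ a‖ with hd
  have hd0 : 0 ≤ d := norm_nonneg _
  have hC0 : 0 ≤ C := by
    have := (abs_nonneg _).trans (hC 0 le_rfl)
    simpa using this
  set z := planeWave (k₁ a) x with hz
  have hz1 : 0 < ‖z - 1‖ := norm_pos_iff.2 (sub_ne_zero.2 hx)
  refine ⟨2 * (c * (2 * d + d ^ 2) + C * (2 + d)) / ‖z - 1‖, fun t ht => ?_⟩
  set b : ℤ × ℤ → ℂ := fun m => planeWave (dualVec a m + k) x with hb
  have hvec : ∀ m : ℤ × ℤ, dualVec a (m + (1, 0)) + k = k₁ a + (dualVec a m + k) := by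
    intro m
    simp only [dualVec, Prod.fst_add, Prod.snd_add, Int.cast_add, Int.cast_one, Int.cast_zero]
    module
  have hshift : ∀ m, b (m + (1, 0)) = z * b m := by
    intro m
    simp only [hb]
    rw [hvec, planeWave_add_left]
  set D := dualDisc ha k t with hD
  set D' := D.map (addRightEmbedding ((1, 0) : ℤ × ℤ)) with hD'
  have hzS : (z - 1) * ∑ m ∈ D, b m = ∑ m ∈ D' \ D, b m - ∑ m ∈ D \ D', b m := by
    rw [Finset.sum_sdiff_sub_sum_sdiff, hD', Finset.sum_map, sub_mul, one_mul, Finset.mul_sum]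
    simp only [addRightEmbedding_apply, hshift]
  have hcard : (D \ D').card = (D' \ D).card :=
    Finset.card_sdiff_comm (by rw [hD', Finset.card_map])
  have hsub : D' \ D ⊆ dualDisc ha k (t + d) \ D := by
    refine Finset.sdiff_subset_sdiff (fun m hm => ?_) le_rfl
    obtain ⟨n, hn, rfl⟩ := Finset.mem_map.1 hm
    rw [hD, mem_dualDisc] at hn
    rw [mem_dualDisc, addRightEmbedding_apply, hvec]
    refine (norm_add_le _ _).trans ?_
    linarith
  have hDsub : D ⊆ dualDisc ha k (t + d) := by
    intro m hm
    rw [hD, mem_dualDisc] at hm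
    rw [mem_dualDisc]
    linarith
  have hcardle : ((D' \ D).card : ℝ) ≤ (c * (2 * d + d ^ 2) + C * (2 + d)) * (1 + t) := by
    have h1 : ((D' \ D).card : ℝ) ≤ ((dualDisc ha k (t + d)).card : ℝ) - D.card := by
      rw [← Nat.cast_sub (Finset.card_le_card hDsub), ← Finset.card_sdiff_of_subset hDsub]
      exact_mod_cast Finset.card_le_card hsub
    have h2 := (abs_le.1 (hC (t + d) (by positivity))).2
    have h3 := (abs_le.1 (hC t ht)).1
    have h4 : 0 ≤ c * d ^ 2 * t := by positivity
    have h5 : 0 ≤ C * d * t := by positivity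
    have h6 : 0 ≤ c * d := by positivity
    nlinarith
  have hnorm : ‖(z - 1) * ∑ m ∈ D, b m‖ ≤ 2 * (D' \ D).card := by
    rw [hzS]
    have hs : ∀ s : Finset (ℤ × ℤ), ‖∑ m ∈ s, b m‖ ≤ s.card := by
      intro s
      refine (norm_sum_le _ _).trans ?_
      simp [hb, norm_planeWave]
    refine (norm_sub_le _ _).trans ?_
    have h1 := hs (D' \ D)
    have h2 := hs (D \ D')
    rw [hcard] at h2
    linarith
  rw [norm_mul] at hnorm
  rw [div_mul_eq_mul_div, le_div_iff₀ hz1]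
  linarith

end Geometry

/-! ### The Bloch waves form an orthogonal basis -/

section Fourier

variable {a : ℝ}

lemma cell_eq_image (a : ℝ) : cell a = planeMap (v₁ a) (v₂ a) '' unitSquare 0 := by
  ext x
  constructor
  · rintro ⟨s, hs, t, ht, rfl⟩
    refine ⟨!₂[s, t], ⟨?_, ?_⟩, ?_⟩
    · simpa [Int.floor_eq_zero_iff] using hs
    · simpa [Int.floor_eq_zero_iff] using ht
    · simp [planeMap_apply]
  · rintro ⟨y, ⟨h0, h1⟩, rfl⟩
    exact ⟨y 0, Int.floor_eq_zero_iff.1 h0, y 1, Int.floor_eq_zero_iff.1 h1, rfl⟩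

lemma injective_planeMap_v (ha : 0 < a) : Function.Injective (planeMap (v₁ a) (v₂ a)) := by
  have h : LinearMap.det (planeMap (v₁ a) (v₂ a) : Plane →ₗ[ℝ] Plane) ≠ 0 := by
    rw [det_planeMap_v]
    exact neg_ne_zero.2 (areaCell_pos ha).ne'
  exact ((LinearMap.equivOfDetNeZero _ h).injective)

lemma integral_cell (ha : 0 < a) (g : Plane → ℂ) :
    ∫ x in cell a, g x =
      (areaCell a : ℂ) * ∫ x in unitSquare 0, g (planeMap (v₁ a) (v₂ a) x) := by
  rw [cell_eq_image, integral_image_eq_integral_abs_det_fderiv_smul volume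
    (measurableSet_unitSquare 0)
    (fun x _ => (planeMap (v₁ a) (v₂ a)).hasFDerivAt.hasFDerivWithinAt)
    (injective_planeMap_v ha).injOn, integral_smul]
  have : (planeMap (v₁ a) (v₂ a)).det = -areaCell a := det_planeMap_v a
  rw [this, abs_neg, abs_of_pos (areaCell_pos ha), Complex.real_smul]

lemma integral_unitSquare (f g : ℝ → ℂ) :
    ∫ x in unitSquare 0, f (x 0) * g (x 1) =
      (∫ t in Set.Ico (0 : ℝ) 1, f t) * ∫ t in Set.Ico (0 : ℝ) 1, g t := by
  have hset : unitSquare 0 = (MeasurableEquiv.toLp 2 (Fin 2 → ℝ)).symm ⁻¹'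
      (Set.univ.pi fun _ => Set.Ico (0 : ℝ) 1) := by
    rw [unitSquare_eq_preimage]
    ext x
    simp [Fin.forall_fin_two]
  have hpre := (EuclideanSpace.volume_preserving_symm_measurableEquiv_toLp
    (Fin 2)).setIntegral_preimage_emb (MeasurableEquiv.measurableEmbedding _)
    (fun y : Fin 2 → ℝ => f (y 0) * g (y 1)) (Set.univ.pi fun _ => Set.Ico (0 : ℝ) 1)
  rw [volume_pi, Measure.restrict_pi_pi] at hpre
  rw [hset]
  refine hpre.trans ?_
  have := integral_fintype_prod_eq_prod (𝕜 := ℂ) (ι := Fin 2)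
    (μ := fun _ => (volume : Measure ℝ).restrict (Set.Ico 0 1)) (f := ![f, g])
  simpa [Fin.prod_univ_two] using this

lemma integral_Ico_exp (n : ℤ) :
    ∫ t in Set.Ico (0 : ℝ) 1, Complex.exp (2 * Real.pi * Complex.I * n * t) =
      if n = 0 then 1 else 0 := by
  rw [integral_Ico_eq_integral_Ioc, ← intervalIntegral.integral_of_le zero_le_one]
  split_ifs with h
  · simp [h]
  · have hc : (2 * Real.pi * Complex.I * n : ℂ) ≠ 0 := by
      simp [h, Real.pi_ne_zero]
    rw [integral_exp_mul_complex hc]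
    have : Complex.exp (2 * Real.pi * Complex.I * n * ((1 : ℝ) : ℂ)) = 1 :=
      Complex.exp_eq_one_iff.2 ⟨n, by push_cast; ring⟩
    rw [this]
    simp

lemma inner_dualVec_planeMap (ha : 0 < a) (m : ℤ × ℤ) (x : Plane) :
    inner ℝ (dualVec a m) (planeMap (v₁ a) (v₂ a) x) =
      2 * Real.pi * m.1 * x 0 + 2 * Real.pi * m.2 * x 1 := by
  rw [planeMap_apply, inner_add_right, inner_smul_right, inner_smul_right,
    real_inner_comm, inner_v₁_dualVec ha, real_inner_comm, inner_v₂_dualVec ha]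
  ring

lemma integral_cell_planeWave (ha : 0 < a) (m : ℤ × ℤ) :
    ∫ x in cell a, planeWave (dualVec a m) x = if m = 0 then (areaCell a : ℂ) else 0 := by
  rw [integral_cell ha]
  have h : ∀ x : Plane, planeWave (dualVec a m) (planeMap (v₁ a) (v₂ a) x) =
      Complex.exp (2 * Real.pi * Complex.I * m.1 * (x 0 : ℝ)) *
      Complex.exp (2 * Real.pi * Complex.I * m.2 * (x 1 : ℝ)) := by
    intro x
    rw [planeWave, inner_dualVec_planeMap ha, ← Complex.exp_add]
    congr 1
    push_cast
    ring
  simp only [h]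
  rw [integral_unitSquare (fun t => Complex.exp (2 * Real.pi * Complex.I * m.1 * t))
    (fun t => Complex.exp (2 * Real.pi * Complex.I * m.2 * t)), integral_Ico_exp, integral_Ico_exp]
  simp only [Prod.ext_iff, Prod.fst_zero, Prod.snd_zero]
  by_cases h1 : m.1 = 0 <;> by_cases h2 : m.2 = 0 <;> simp [h1, h2]

lemma dualVec_sub (m n : ℤ × ℤ) : dualVec a (n - m) = dualVec a n - dualVec a m := by
  simp only [dualVec, Prod.fst_sub, Prod.snd_sub, Int.cast_sub]
  module

lemma inner_blochWave_eq_integral (k : Plane) (m : ℤ × ℤ) (f : L2Cell a) :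
    inner ℂ (blochWave a k m) f =
      ∫ x in cell a, starRingEnd ℂ (planeWave (dualVec a m + k) x) * f x := by
  rw [L2.inner_def]
  refine integral_congr_ae ?_
  filter_upwards [(memLp_planeWave a (dualVec a m + k)).coeFn_toLp] with x hx
  rw [blochWave, hx, RCLike.inner_apply, mul_comm]

lemma inner_blochWave_blochWave (ha : 0 < a) (k : Plane) (m n : ℤ × ℤ) :
    inner ℂ (blochWave a k m) (blochWave a k n) = if m = n then (areaCell a : ℂ) else 0 := by
  have h := integral_cell_planeWave ha (n - m)
  simp only [sub_eq_zero, eq_comm (a := n)] at h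
  rw [inner_blochWave_eq_integral, ← h]
  refine integral_congr_ae ?_
  filter_upwards [(memLp_planeWave a (dualVec a n + k)).coeFn_toLp] with x hx
  rw [blochWave, hx, show dualVec a n + k = dualVec a (n - m) + (dualVec a m + k) by
    rw [dualVec_sub]; abel, planeWave_add_left (dualVec a (n - m)), mul_left_comm,
    mul_comm (starRingEnd ℂ _), Complex.mul_conj, Complex.normSq_eq_norm_sq, norm_planeWave]
  simp

/-- The projection of the plane to the unit torus along `v₁, v₂`. -/
def toTorus (a : ℝ) (x : Plane) : UnitAddTorus (Fin 2) := fun i =>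
  ((inner ℝ (![k₁ a, k₂ a] i) x / (2 * Real.pi) : ℝ) : UnitAddCircle)

/-- The representative in the fundamental cell of a point of the unit torus. -/
def ofTorus (a : ℝ) (t : UnitAddTorus (Fin 2)) : Plane :=
  ((AddCircle.measurableEquivIco 1 0 (t 0) : Set.Ico (0 : ℝ) (0 + 1)) : ℝ) • v₁ a +
    ((AddCircle.measurableEquivIco 1 0 (t 1) : Set.Ico (0 : ℝ) (0 + 1)) : ℝ) • v₂ a

lemma continuous_toTorus (a : ℝ) : Continuous (toTorus a) := by
  refine continuous_pi fun i => ?_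
  exact (AddCircle.continuous_mk' 1).comp (by fun_prop)

lemma measurable_ofTorus (a : ℝ) : Measurable (ofTorus a) := by
  have h : ∀ i : Fin 2, Measurable fun t : UnitAddTorus (Fin 2) =>
      ((AddCircle.measurableEquivIco 1 0 (t i) : Set.Ico (0 : ℝ) (0 + 1)) : ℝ) := fun i =>
    measurable_subtype_coe.comp
      ((AddCircle.measurableEquivIco 1 0).measurable.comp (measurable_pi_apply i))
  exact ((h 0).smul_const _).add ((h 1).smul_const _)

lemma ofTorus_toTorus (ha : 0 < a) {x : Plane} (hx : x ∈ cell a) : ofTorus a (toTorus a x) = x := by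
  obtain ⟨s, hs, t, ht, rfl⟩ := hx
  have h0 : toTorus a (s • v₁ a + t • v₂ a) 0 = (s : UnitAddCircle) := by
    simp only [toTorus, Matrix.cons_val_zero, inner_add_right, inner_smul_right, inner_k₁_v₁ ha,
      inner_k₁_v₂]
    congr 1
    field_simp [Real.pi_ne_zero]
    ring
  have h1 : toTorus a (s • v₁ a + t • v₂ a) 1 = (t : UnitAddCircle) := by
    simp only [toTorus, Matrix.cons_val_one, Matrix.cons_val_zero, inner_add_right, inner_smul_right, inner_k₂_v₂ ha,
      inner_k₂_v₁]
    congr 1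
    field_simp [Real.pi_ne_zero]
    ring
  have key : ∀ u : ℝ, u ∈ Set.Ico (0 : ℝ) 1 →
      ((AddCircle.measurableEquivIco 1 0 (u : UnitAddCircle) : Set.Ico (0 : ℝ) (0 + 1)) : ℝ) = u := by
    intro u hu
    have hu' : u ∈ Set.Ico (0 : ℝ) (0 + 1) := by simpa using hu
    exact congrArg Subtype.val (AddCircle.equivIco_coe_eq (p := (1 : ℝ)) (a := 0) hu')
  rw [ofTorus, h0, h1, key s hs, key t ht]

lemma mFourier_toTorus (a : ℝ) (m : ℤ × ℤ) (x : Plane) :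
    UnitAddTorus.mFourier ![m.1, m.2] (toTorus a x) = planeWave (dualVec a m) x := by
  simp only [UnitAddTorus.mFourier, ContinuousMap.coe_mk, Fin.prod_univ_two, toTorus,
    Matrix.cons_val_zero, Matrix.cons_val_one, fourier_coe_apply]
  rw [← Complex.exp_add, planeWave, dualVec, inner_add_left, real_inner_smul_left,
    real_inner_smul_left]
  congr 1
  push_cast
  field_simp

/-- The Bloch waves are complete in `L²_k(Γ)`. -/
theorem eq_zero_of_inner_blochWave (ha : 0 < a) (k : Plane) (f : L2Cell a)
    (hf : ∀ m, inner ℂ (blochWave a k m) f = 0) : f = 0 := by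
  set μ := (volume : Measure Plane).restrict (cell a) with hμ
  have hΦ : Measurable (toTorus a) := (continuous_toTorus a).measurable
  set ν := μ.map (toTorus a) with hν
  have : IsFiniteMeasure ν := Measure.isFiniteMeasure_map _ _
  set F : UnitAddTorus (Fin 2) → ℂ := fun t =>
    starRingEnd ℂ (planeWave k (ofTorus a t)) * f (ofTorus a t) with hF
  have hpw : Continuous (planeWave k) := by unfold planeWave; fun_prop
  have hFm : StronglyMeasurable F := by
    refine StronglyMeasurable.mul ?_ ((Lp.stronglyMeasurable f).comp_measurable
      (measurable_ofTorus a))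
    exact ((Complex.continuous_conj.comp hpw).stronglyMeasurable).comp_measurable
      (measurable_ofTorus a)
  have hcell : MeasurableSet (cell a) := by
    rw [cell_eq_image]
    exact (measurableSet_unitSquare 0).image_of_continuousOn_injOn
      (planeMap (v₁ a) (v₂ a)).continuous.continuousOn (injective_planeMap_v ha).injOn
  have hFΦ : ∀ᵐ x ∂μ, F (toTorus a x) = starRingEnd ℂ (planeWave k x) * f x := by
    filter_upwards [ae_restrict_mem hcell] with x hx
    simp only [hF, ofTorus_toTorus ha hx]
  have hFLp : MemLp F 2 ν := by
    rw [hν, memLp_map_measure_iff hFm.aestronglyMeasurable hΦ.aemeasurable]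
    refine (Lp.memLp f).of_le (hFm.comp_measurable hΦ).aestronglyMeasurable ?_
    filter_upwards [hFΦ] with x hx
    rw [Function.comp_apply, hx, norm_mul, RCLike.norm_conj, norm_planeWave, one_mul]
  have horth : ∀ n : Fin 2 → ℤ,
      inner ℂ (ContinuousMap.toLp (E := ℂ) 2 ν ℂ (UnitAddTorus.mFourier n)) (hFLp.toLp F) = 0 := by
    intro n
    rw [← hf (n 0, n 1), inner_blochWave_eq_integral, L2.inner_def]
    have h1 : ∀ᵐ t ∂ν, inner ℂ ((ContinuousMap.toLp (E := ℂ) 2 ν ℂ (UnitAddTorus.mFourier n)) t)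
        (hFLp.toLp F t) = starRingEnd ℂ (UnitAddTorus.mFourier n t) * F t := by
      filter_upwards [ContinuousMap.coeFn_toLp (p := 2) (𝕜 := ℂ) ν (UnitAddTorus.mFourier n),
        hFLp.coeFn_toLp] with t ht1 ht2
      rw [ht1, ht2, RCLike.inner_apply, mul_comm]
    rw [integral_congr_ae h1, hν, integral_map hΦ.aemeasurable]
    · refine integral_congr_ae ?_
      filter_upwards [hFΦ] with x hx
      have hn : n = ![(n 0, n 1).1, (n 0, n 1).2] := by ext i; fin_cases i <;> rfl
      rw [hx, hn, mFourier_toTorus, planeWave_add_left, map_mul]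
      simp only [Matrix.cons_val_zero, Matrix.cons_val_one]
      ring
    · exact ((Complex.continuous_conj.comp
        (UnitAddTorus.mFourier n).continuous).aestronglyMeasurable).mul hFm.aestronglyMeasurable
  have hdense : (Submodule.span ℂ (Set.range fun n : Fin 2 → ℤ =>
      ContinuousMap.toLp (E := ℂ) 2 ν ℂ (UnitAddTorus.mFourier n))).topologicalClosure = ⊤ := by
    simpa only [Submodule.map_span, ContinuousLinearMap.coe_coe, ← Set.range_comp,
      Function.comp_def] using
      (ContinuousMap.toLp_denseRange ℂ ν ℂ (p := 2) (by simp)).topologicalClosure_map_submodule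
        UnitAddTorus.span_mFourier_closure_eq_top
  rw [Submodule.topologicalClosure_eq_top_iff] at hdense
  have hF0 : hFLp.toLp F = 0 := by
    rw [← Submodule.mem_bot ℂ, ← hdense, Submodule.mem_orthogonal]
    intro u hu
    induction hu using Submodule.span_induction with
    | mem u hu => obtain ⟨n, rfl⟩ := hu; exact horth n
    | zero => simp
    | add u v _ _ hu hv => rw [inner_add_left, hu, hv, add_zero]
    | smul c u _ hu => rw [inner_smul_left, hu, mul_zero]
  have hF0' : ∀ᵐ t ∂ν, F t = 0 := by
    filter_upwards [hFLp.coeFn_toLp, Lp.coeFn_zero ℂ 2 ν] with t h1 h2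
    rw [← h1, hF0, h2, Pi.zero_apply]
  refine Lp.eq_zero_iff_ae_eq_zero.2 ?_
  filter_upwards [ae_of_ae_map hΦ.aemeasurable hF0', hFΦ] with x h1 h2
  rw [h1] at h2
  have hne : starRingEnd ℂ (planeWave k x) ≠ 0 := by
    rw [← norm_ne_zero_iff, RCLike.norm_conj, norm_planeWave]
    exact one_ne_zero
  simpa [hne] using h2.symm

/-- The normalized Bloch waves as a Hilbert basis. -/
def blochBasis (ha : 0 < a) (k : Plane) : HilbertBasis (ℤ × ℤ) ℂ (L2Cell a) :=
  HilbertBasis.mkOfOrthogonalEqBot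
    (v := fun m => (((√(areaCell a))⁻¹ : ℝ) : ℂ) • blochWave a k m)
    (by
      rw [orthonormal_iff_ite]
      intro m n
      rw [inner_smul_left, inner_smul_right, inner_blochWave_blochWave ha, Complex.conj_ofReal]
      split_ifs
      · rw [← Complex.ofReal_mul, ← Complex.ofReal_mul, Complex.ofReal_eq_one]
        have h := Real.mul_self_sqrt (areaCell_pos ha).le
        have h0 : √(areaCell a) ≠ 0 := (Real.sqrt_pos.2 (areaCell_pos ha)).ne'
        nth_rewrite 3 [← h]
        field_simp
      · simp)
    (by
      rw [Submodule.eq_bot_iff]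
      intro f hf
      refine eq_zero_of_inner_blochWave ha k f fun m => ?_
      have h := Submodule.inner_right_of_mem_orthogonal (Submodule.subset_span (Set.mem_range_self m)) hf
      rw [inner_smul_left] at h
      have h0 : √(areaCell a) ≠ 0 := (Real.sqrt_pos.2 (areaCell_pos ha)).ne'
      simpa [h0] using h)

lemma blochBasis_repr (ha : 0 < a) (k : Plane) (f : L2Cell a) (m : ℤ × ℤ) :
    (blochBasis ha k).repr f m =
      (((√(areaCell a))⁻¹ : ℝ) : ℂ) * inner ℂ (blochWave a k m) f := by
  rw [HilbertBasis.repr_apply_apply, blochBasis, HilbertBasis.coe_mkOfOrthogonalEqBot,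
    inner_smul_left, Complex.conj_ofReal]

lemma ext_inner_blochWave (ha : 0 < a) (k : Plane) {f g : L2Cell a}
    (h : ∀ m, inner ℂ (blochWave a k m) f = inner ℂ (blochWave a k m) g) : f = g := by
  refine sub_eq_zero.1 (eq_zero_of_inner_blochWave ha k _ fun m => ?_)
  rw [inner_sub_right, h, sub_self]

lemma hasSum_inner_blochWave (ha : 0 < a) (k : Plane) (f g : L2Cell a) :
    HasSum (fun m => starRingEnd ℂ (inner ℂ (blochWave a k m) f) * inner ℂ (blochWave a k m) g)
      (areaCell a * inner ℂ f g) := by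
  have h := ((blochBasis ha k).hasSum_inner_mul_inner f g).mul_left (areaCell a : ℂ)
  refine h.congr_fun fun m => ?_
  rw [← inner_conj_symm f, ← HilbertBasis.repr_apply_apply, ← HilbertBasis.repr_apply_apply,
    blochBasis_repr, blochBasis_repr, map_mul, Complex.conj_ofReal]
  have h := Real.mul_self_sqrt (areaCell_pos ha).le
  have h0 : (√(areaCell a) : ℂ) ≠ 0 := by
    exact_mod_cast (Real.sqrt_pos.2 (areaCell_pos ha)).ne'
  have h2 : (areaCell a : ℂ) = √(areaCell a) * √(areaCell a) := by exact_mod_cast h.symm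
  rw [h2]
  push_cast
  field_simp

lemma hasSum_norm_inner_blochWave_sq (ha : 0 < a) (k : Plane) (f : L2Cell a) :
    HasSum (fun m => ‖inner ℂ (blochWave a k m) f‖ ^ 2) (areaCell a * ‖f‖ ^ 2) := by
  have h := hasSum_inner_blochWave ha k f f
  rw [← Complex.hasSum_ofReal]
  convert h using 2 with m
  · rw [← Complex.normSq_eq_norm_sq, mul_comm, Complex.mul_conj]
  · rw [inner_self_eq_norm_sq_to_K]
    push_cast
    rfl

lemma exists_inner_blochWave_eq (ha : 0 < a) (k : Plane) (c : ℤ × ℤ → ℂ)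
    (hc : Summable fun m => ‖c m‖ ^ 2) :
    ∃ f : L2Cell a, ∀ m, inner ℂ (blochWave a k m) f = c m := by
  have h0 : (√(areaCell a) : ℂ) ≠ 0 := by
    exact_mod_cast (Real.sqrt_pos.2 (areaCell_pos ha)).ne'
  have hmem : Memℓp (fun m => (((√(areaCell a))⁻¹ : ℝ) : ℂ) * c m) 2 := by
    refine memℓp_gen ?_
    have := hc.mul_left (‖(((√(areaCell a))⁻¹ : ℝ) : ℂ)‖ ^ 2)
    refine this.congr fun m => ?_
    rw [norm_mul]
    norm_num [mul_pow]
  refine ⟨(blochBasis ha k).repr.symm ⟨_, hmem⟩, fun m => ?_⟩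
  have h := blochBasis_repr ha k ((blochBasis ha k).repr.symm ⟨_, hmem⟩) m
  rw [LinearIsometryEquiv.apply_symm_apply] at h
  have h' : (((√(areaCell a))⁻¹ : ℝ) : ℂ) ≠ 0 := by
    rw [Complex.ofReal_inv]
    exact inv_ne_zero h0
  exact (mul_left_cancel₀ h' h).symm

/-- Bounded Fourier multipliers. -/
lemma exists_multiplier (ha : 0 < a) (k : Plane) (c : ℤ × ℤ → ℂ) (C : ℝ) (hc : ∀ m, ‖c m‖ ≤ C) :
    ∃ R : L2Cell a →L[ℂ] L2Cell a, ∀ f m,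
      inner ℂ (blochWave a k m) (R f) = c m * inner ℂ (blochWave a k m) f := by
  have hC : 0 ≤ C := (norm_nonneg _).trans (hc 0)
  have hle : ∀ f : L2Cell a, ∀ m, ‖c m * inner ℂ (blochWave a k m) f‖ ^ 2 ≤
      C ^ 2 * ‖inner ℂ (blochWave a k m) f‖ ^ 2 := by
    intro f m
    rw [norm_mul, mul_pow]
    gcongr
    exact hc m
  have hex : ∀ f : L2Cell a, ∃ g : L2Cell a, ∀ m,
      inner ℂ (blochWave a k m) g = c m * inner ℂ (blochWave a k m) f := fun f =>
    exists_inner_blochWave_eq ha k _ (Summable.of_nonneg_of_le (fun m => by positivity) (hle f)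
      ((hasSum_norm_inner_blochWave_sq ha k f).summable.mul_left _))
  choose R hR using hex
  let L : L2Cell a →ₗ[ℂ] L2Cell a :=
    { toFun := R
      map_add' := fun f g => ext_inner_blochWave ha k fun m => by
        simp only [hR, inner_add_right, mul_add]
      map_smul' := fun s f => ext_inner_blochWave ha k fun m => by
        simp only [hR, inner_smul_right, RingHom.id_apply]
        ring }
  refine ⟨L.mkContinuous C fun f => ?_, fun f m => hR f m⟩
  have h1 := hasSum_norm_inner_blochWave_sq ha k (R f)
  have h2 := (hasSum_norm_inner_blochWave_sq ha k f).mul_left (C ^ 2)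
  have h3 := hasSum_le (fun m => by rw [hR]; exact hle f m) h1 h2
  have hA := areaCell_pos ha
  have h4 : ‖R f‖ ^ 2 ≤ (C * ‖f‖) ^ 2 := by
    refine le_of_mul_le_mul_left ?_ hA
    calc _ ≤ _ := h3
      _ = _ := by ring
  exact le_of_sq_le_sq h4 (by positivity)

end Fourier

/-! ### Green's function -/

section Green

variable {a : ℝ}

/-- `lam` is not of the form `|ξ_m + k|²`. -/
def IsRegular (a : ℝ) (k : Plane) (lam : ℂ) : Prop :=
  ∀ m : ℤ × ℤ, ((‖dualVec a m + k‖ ^ 2 : ℝ) : ℂ) - lam ≠ 0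

lemma IsRegular.conj {k : Plane} {lam : ℂ} (h : IsRegular a k lam) :
    IsRegular a k (starRingEnd ℂ lam) := fun m hm => h m <| by
  simpa using congrArg (starRingEnd ℂ) hm

lemma isRegular_of_im_ne_zero (a : ℝ) (k : Plane) {lam : ℂ} (h : lam.im ≠ 0) :
    IsRegular a k lam := fun m hm => h <| by
  have := congrArg Complex.im hm
  rw [Complex.sub_im, Complex.ofReal_im] at this
  simpa using this

lemma isRegular_neg_one (a : ℝ) (k : Plane) : IsRegular a k (-1) := fun m hm => by
  have : (‖dualVec a m + k‖ ^ 2 + 1 : ℝ) ≠ 0 := by positivity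
  apply this
  rw [sub_neg_eq_add] at hm
  exact_mod_cast hm

lemma IsRegular.exists_norm_inv_le (ha : 0 < a) {k : Plane} {lam : ℂ} (h : IsRegular a k lam) :
    ∃ C : ℝ, 0 ≤ C ∧ ∀ m : ℤ × ℤ, ‖(((‖dualVec a m + k‖ ^ 2 : ℝ) : ℂ) - lam)⁻¹‖ ≤
      C * (‖dualVec a m + k‖ ^ 2 + 1)⁻¹ := by
  set q : ℤ × ℤ → ℂ := fun m => ((‖dualVec a m + k‖ ^ 2 : ℝ) : ℂ) - lam with hq
  have hex : ∃ C₀ : ℝ, 0 ≤ C₀ ∧ ∀ m, ‖(q m)⁻¹‖ ≤ C₀ := by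
    refine ⟨1 + ∑ m ∈ dualDisc ha k (‖lam‖ + 1), ‖(q m)⁻¹‖, by positivity, fun m => ?_⟩
    by_cases hm : m ∈ dualDisc ha k (‖lam‖ + 1)
    · have := Finset.single_le_sum (f := fun m => ‖(q m)⁻¹‖) (fun _ _ => norm_nonneg _) hm
      linarith
    · rw [mem_dualDisc, not_le] at hm
      have h1 : 1 ≤ ‖q m‖ := by
        have h2 := norm_sub_norm_le ((‖dualVec a m + k‖ ^ 2 : ℝ) : ℂ) lam
        rw [Complex.norm_real, Real.norm_of_nonneg (by positivity)] at h2
        nlinarith [norm_nonneg lam]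
      have h3 : ‖(q m)⁻¹‖ ≤ 1 := by
        rw [norm_inv]
        exact inv_le_one_of_one_le₀ h1
      have : 0 ≤ ∑ m ∈ dualDisc ha k (‖lam‖ + 1), ‖(q m)⁻¹‖ := by positivity
      linarith
  obtain ⟨C₀, hC₀, hle⟩ := hex
  refine ⟨1 + ‖lam + 1‖ * C₀, by positivity, fun m => ?_⟩
  have hpos : 0 < ‖dualVec a m + k‖ ^ 2 + 1 := by positivity
  rw [← div_eq_mul_inv, le_div_iff₀ hpos]
  have hn : ‖dualVec a m + k‖ ^ 2 + 1 = ‖q m + (lam + 1)‖ := by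
    have : q m + (lam + 1) = ((‖dualVec a m + k‖ ^ 2 + 1 : ℝ) : ℂ) := by
      simp only [hq]
      push_cast
      ring
    rw [this, Complex.norm_real, Real.norm_of_nonneg hpos.le]
  calc ‖(q m)⁻¹‖ * (‖dualVec a m + k‖ ^ 2 + 1) ≤ ‖(q m)⁻¹‖ * (‖q m‖ + ‖lam + 1‖) := by
        rw [hn]
        gcongr
        exact norm_add_le _ _
    _ = 1 + ‖lam + 1‖ * ‖(q m)⁻¹‖ := by
        rw [mul_add, ← norm_mul, inv_mul_cancel₀ (h m), norm_one]
        ring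
    _ ≤ _ := by
        gcongr
        exact hle m

lemma IsRegular.summable_greenTerm_div (ha : 0 < a) {k : Plane} {lam mu : ℂ}
    (h : IsRegular a k lam) (h' : IsRegular a k mu) (x : Plane) :
    Summable fun m => greenTerm a k lam x m / (((‖dualVec a m + k‖ ^ 2 : ℝ) : ℂ) - mu) := by
  obtain ⟨C, hC, hle⟩ := h.exists_norm_inv_le ha
  obtain ⟨C', hC', hle'⟩ := h'.exists_norm_inv_le ha
  refine Summable.of_norm_bounded ((summable_inv_sq_add_one_sq ha k).mul_left (C * C'))
    fun m => ?_
  rw [greenTerm, div_eq_mul_inv, div_eq_mul_inv, norm_mul, norm_mul, norm_planeWave, one_mul]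
  refine (mul_le_mul (hle m) (hle' m) (norm_nonneg _) (by positivity)).trans (le_of_eq ?_)
  rw [← inv_pow]
  ring

lemma IsRegular.summable_norm_greenTerm_sq (ha : 0 < a) {k : Plane} {lam : ℂ}
    (h : IsRegular a k lam) (x : Plane) : Summable fun m => ‖greenTerm a k lam x m‖ ^ 2 := by
  refine ((h.summable_greenTerm_div ha h x).norm).congr fun m => ?_
  rw [greenTerm, norm_div, norm_div, norm_planeWave]
  ring

lemma inner_blochWave_greenL2 (ha : 0 < a) {k : Plane} {lam : ℂ} (h : IsRegular a k lam)
    (y : Plane) (m : ℤ × ℤ) :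
    inner ℂ (blochWave a k m) (greenL2 a k lam y) = greenTerm a k lam (-y) m := by
  obtain ⟨g, hg⟩ := exists_inner_blochWave_eq ha k _ (h.summable_norm_greenTerm_sq ha (-y))
  have hA : (areaCell a : ℂ) ≠ 0 := by exact_mod_cast (areaCell_pos ha).ne'
  have hsum : HasSum (fun m => greenTerm a k lam (-y) m • blochWave a k m)
      ((areaCell a : ℂ) • g) := by
    refine (((blochBasis ha k).hasSum_repr g).const_smul (areaCell a : ℂ)).congr_fun fun m => ?_
    rw [blochBasis_repr, hg, blochBasis, HilbertBasis.coe_mkOfOrthogonalEqBot, smul_smul, smul_smul]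
    congr 1
    have h := Real.mul_self_sqrt (areaCell_pos ha).le
    have h0 : (√(areaCell a) : ℂ) ≠ 0 := by
      exact_mod_cast (Real.sqrt_pos.2 (areaCell_pos ha)).ne'
    have h2 : (areaCell a : ℂ) = √(areaCell a) * √(areaCell a) := by exact_mod_cast h.symm
    rw [h2]
    push_cast
    field_simp
  rw [greenL2, hsum.tsum_eq, smul_smul, inv_mul_cancel₀ hA, one_smul, hg]

lemma conj_greenTerm (a : ℝ) (k : Plane) (lam : ℂ) (x : Plane) (m : ℤ × ℤ) :
    starRingEnd ℂ (greenTerm a k lam x m) = greenTerm a k (starRingEnd ℂ lam) (-x) m := by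
  rw [greenTerm, greenTerm, map_div₀, map_sub, conj_planeWave, Complex.conj_ofReal]

/-- The pairing with `greenL2` evaluates the resolvent of the Laplacian at a point. -/
lemma hasSum_inner_greenL2 (ha : 0 < a) {k : Plane} {lam : ℂ} (h : IsRegular a k lam)
    (y : Plane) (f : L2Cell a) :
    HasSum (fun m => greenTerm a k lam y m * inner ℂ (blochWave a k m) f)
      (areaCell a * inner ℂ (greenL2 a k (starRingEnd ℂ lam) y) f) := by
  refine (hasSum_inner_blochWave ha k _ f).congr_fun fun m => ?_
  rw [inner_blochWave_greenL2 ha h.conj, conj_greenTerm, neg_neg, Complex.conj_conj]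

/-- The coefficient of the logarithmic divergence of Green's function at `x`. -/
def logCoeff (a : ℝ) (x : Plane) : ℝ :=
  open scoped Classical in if x ∈ triangularLattice a then Real.pi / areaBrillouin a else 0

/-- The points at which Green's function enters the matrix `Γ_{α,Y}`. -/
def IsSiteDifference (a : ℝ) (x : Plane) : Prop := x = 0 ∨ x = x₀ a ∨ x = -x₀ a

lemma IsSiteDifference.neg {x : Plane} (hx : IsSiteDifference a x) : IsSiteDifference a (-x) := by
  rcases hx with rfl | rfl | rfl
  · exact Or.inl neg_zero
  · exact Or.inr (Or.inr rfl)
  · exact Or.inr (Or.inl (neg_neg _))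

lemma isSiteDifference_site (a : ℝ) (i j : Fin 2) : IsSiteDifference a (site a i - site a j) := by
  fin_cases i <;> fin_cases j <;> simp [site, IsSiteDifference]

lemma planeWave_k₁_x₀_ne_one (ha : 0 < a) : planeWave (k₁ a) (x₀ a) ≠ 1 := by
  rw [Ne, planeWave_eq_one_iff, inner_k₁_x₀ ha]
  rintro ⟨n, hn⟩
  have h1 : Real.pi * (2 - 3 * n : ℝ) = 0 := by linarith
  have h2 : (2 - 3 * n : ℝ) = 0 := by simpa [Real.pi_ne_zero] using h1
  have h3 : (2 - 3 * n : ℤ) = 0 := by exact_mod_cast h2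
  omega

lemma IsSiteDifference.exists_norm_sum_sub_le (ha : 0 < a) (k : Plane) {x : Plane}
    (hx : IsSiteDifference a x) :
    ∃ C : ℝ, ∀ t, 0 ≤ t → ‖∑ m ∈ dualDisc ha k t, planeWave (dualVec a m + k) x -
      ((logCoeff a x * t ^ 2 : ℝ) : ℂ)‖ ≤ C * (1 + t) := by
  rcases hx with rfl | rfl | rfl
  · obtain ⟨C, hC⟩ := exists_abs_card_dualDisc_sub_le ha k
    refine ⟨C, fun t ht => ?_⟩
    simp only [planeWave_zero_right, Finset.sum_const, nsmul_eq_mul, mul_one, logCoeff,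
      zero_mem_triangularLattice, if_true]
    rw [← Complex.ofReal_natCast, ← Complex.ofReal_sub, Complex.norm_real]
    exact hC t ht
  · obtain ⟨C, hC⟩ := exists_norm_sum_planeWave_le ha k (planeWave_k₁_x₀_ne_one ha)
    refine ⟨C, fun t ht => ?_⟩
    simpa [logCoeff, x₀_notMem_triangularLattice ha] using hC t ht
  · have hne : planeWave (k₁ a) (-x₀ a) ≠ 1 := by
      rw [← conj_planeWave]
      intro h
      exact planeWave_k₁_x₀_ne_one ha (by simpa using congrArg (starRingEnd ℂ) h)
    obtain ⟨C, hC⟩ := exists_norm_sum_planeWave_le ha k hne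
    refine ⟨C, fun t ht => ?_⟩
    simpa [logCoeff, neg_x₀_notMem_triangularLattice ha] using hC t ht

lemma IsRegular.summable_greenTerm_sub (ha : 0 < a) {k : Plane} {lam mu : ℂ}
    (h : IsRegular a k lam) (h' : IsRegular a k mu) (x : Plane) :
    Summable fun m => greenTerm a k lam x m - greenTerm a k mu x m := by
  refine ((h.summable_greenTerm_div ha h' x).mul_left (lam - mu)).congr fun m => ?_
  have := h m
  have := h' m
  rw [greenTerm, greenTerm]
  field_simp
  ring

/-- The limits defining Green's function at the differences of the scatterers exist. -/
theorem tendsto_green (ha : 0 < a) {k : Plane} {lam : ℂ} (h : IsRegular a k lam) {x : Plane}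
    (hx : IsSiteDifference a x) :
    Tendsto (fun r : ℝ => ∑ m ∈ dualDisc ha k r, greenTerm a k lam x m -
      ((2 * logCoeff a x * Real.log r : ℝ) : ℂ)) atTop (𝓝 (areaCell a * green a k lam x)) := by
  obtain ⟨C, hC⟩ := hx.exists_norm_sum_sub_le ha k
  obtain ⟨L, hL⟩ := exists_tendsto_sum_div (fun m => ‖dualVec a m + k‖) (dualDisc ha k)
    (fun m => planeWave (dualVec a m + k) x) (fun _ => norm_nonneg _)
    (fun m r => mem_dualDisc ha k m r) (logCoeff a x) C hC
  have hs := (h.summable_greenTerm_sub ha (isRegular_neg_one a k) x).hasSum.comp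
    (tendsto_dualDisc ha k)
  have hlim := (hL.add hs).congr (f₂ := fun r : ℝ => ∑ m ∈ dualDisc ha k r, greenTerm a k lam x m -
      ((2 * logCoeff a x * Real.log r : ℝ) : ℂ)) fun r => by
    simp only [Function.comp_apply, Finset.sum_sub_distrib]
    have : ∀ m, greenTerm a k (-1) x m =
        planeWave (dualVec a m + k) x / ((‖dualVec a m + k‖ ^ 2 + 1 : ℝ) : ℂ) := by
      intro m
      rw [greenTerm, sub_neg_eq_add]
      push_cast
      rfl
    simp only [this]
    ring
  have hA : (areaCell a : ℂ) ≠ 0 := by exact_mod_cast (areaCell_pos ha).ne'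
  have hfin : ∀ (f : ℤ × ℤ → ℂ) (r : ℝ), ∑ᶠ m ∈ {m : ℤ × ℤ | ‖dualVec a m + k‖ ≤ r}, f m =
      ∑ m ∈ dualDisc ha k r, f m := fun f r =>
    finsum_mem_eq_finite_toFinset_sum f (finite_norm_dualVec_add_le ha k r)
  convert hlim using 2
  rw [green]
  split_ifs with hmem
  · have hx0 : x = 0 := by
      rcases hx with rfl | rfl | rfl
      · rfl
      · exact absurd hmem (x₀_notMem_triangularLattice ha)
      · exact absurd hmem (neg_x₀_notMem_triangularLattice ha)
    rw [mul_inv_cancel_left₀ hA]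
    refine Tendsto.limUnder_eq (hlim.congr fun r => ?_)
    rw [hfin]
    congr 1
    · simp only [greenTerm, hx0, planeWave_zero_right]
    · rw [logCoeff, if_pos hmem, mul_div_assoc]
  · rw [mul_inv_cancel_left₀ hA]
    refine Tendsto.limUnder_eq (hlim.congr fun r => ?_)
    rw [hfin, logCoeff, if_neg hmem]
    simp

lemma conj_green (ha : 0 < a) {k : Plane} {lam : ℂ} (h : IsRegular a k lam) {x : Plane}
    (hx : IsSiteDifference a x) :
    starRingEnd ℂ (green a k lam x) = green a k (starRingEnd ℂ lam) (-x) := by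
  have hA : (areaCell a : ℂ) ≠ 0 := by exact_mod_cast (areaCell_pos ha).ne'
  have h1 := (Complex.continuous_conj.tendsto _).comp (tendsto_green ha h hx)
  have h2 := tendsto_green ha h.conj hx.neg
  have hlog : logCoeff a (-x) = logCoeff a x := by
    have : -x ∈ triangularLattice a ↔ x ∈ triangularLattice a :=
      ⟨fun h => by simpa using neg_mem_triangularLattice h, neg_mem_triangularLattice⟩
    rw [logCoeff, logCoeff]
    split_ifs <;> first | rfl | tauto
  have h3 := tendsto_nhds_unique h1 (h2.congr fun r => by
    simp only [Function.comp_apply, map_sub, map_sum, conj_greenTerm, Complex.conj_ofReal, hlog])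
  rw [map_mul, Complex.conj_ofReal] at h3
  exact mul_left_cancel₀ hA h3

/-- The first resolvent identity for Green's function. -/
theorem green_sub_green (ha : 0 < a) {k : Plane} {lam mu : ℂ} (h : IsRegular a k lam)
    (h' : IsRegular a k mu) {y y' : Plane} (hx : IsSiteDifference a (y - y')) :
    green a k lam (y - y') - green a k mu (y - y') =
      (lam - mu) * inner ℂ (greenL2 a k (starRingEnd ℂ mu) y) (greenL2 a k lam y') := by
  have hA : (areaCell a : ℂ) ≠ 0 := by exact_mod_cast (areaCell_pos ha).ne'
  have h1 := (tendsto_green ha h hx).sub (tendsto_green ha h' hx)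
  have h2 := ((hasSum_inner_greenL2 ha h' y (greenL2 a k lam y')).mul_left (lam - mu)).comp
    (tendsto_dualDisc ha k)
  have h3 := tendsto_nhds_unique h1 (h2.congr fun r => by
    simp only [Function.comp_apply]
    rw [sub_sub_sub_cancel_right, ← Finset.sum_sub_distrib]
    refine Finset.sum_congr rfl fun m _ => ?_
    rw [inner_blochWave_greenL2 ha h]
    have := h m
    have := h' m
    simp only [greenTerm, sub_eq_add_neg y, planeWave_add_right]
    field_simp
    ring)
  refine mul_left_cancel₀ hA ?_
  rw [mul_sub, h3]
  ring

end Green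

/-! ### Unbounded operators in terms of their graphs -/

section OperatorGraphs

variable {H : Type*} [NormedAddCommGroup H] [InnerProductSpace ℂ H]

lemma notMem_opSpectrum_iff (T : H →ₗ.[ℂ] H) (z : ℂ) :
    z ∉ opSpectrum T ↔ ∃ R : H →L[ℂ] H, (∀ f, (R f, f + z • R f) ∈ T.graph) ∧
      ∀ p ∈ T.graph, R (p.2 - z • p.1) = p.1 := by
  rw [opSpectrum, Set.mem_ofPred_eq, not_not]
  refine exists_congr fun R => and_congr (forall_congr' fun f => ?_) ?_
  · rw [LinearPMap.mem_graph_iff]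
    refine exists_congr fun u => and_congr_right fun hu => ?_
    rw [hu, sub_eq_iff_eq_add]
  · constructor
    · rintro h p hp
      obtain ⟨u, hu, hu'⟩ := (LinearPMap.mem_graph_iff T).1 hp
      rw [← hu, ← hu', h]
    · intro h u
      exact h _ (T.mem_graph u)

lemma mem_map_opEigenspace_iff (T : H →ₗ.[ℂ] H) (z : ℂ) (u : H) :
    u ∈ (opEigenspace T z).map T.domain.subtype ↔ (u, z • u) ∈ T.graph := by
  rw [LinearPMap.mem_graph_iff, Submodule.mem_map]
  refine exists_congr fun v => ?_
  rw [opEigenspace, LinearMap.mem_ker, LinearMap.sub_apply, sub_eq_zero, and_comm]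
  refine and_congr_right fun hv => ?_
  rw [← hv]
  rfl

end OperatorGraphs

/-! ### The fiber operator in terms of point charges -/

section PointCharges

variable {a : ℝ}

lemma floquetLaplacian_graph (ha : 0 < a) (k : Plane) :
    (floquetLaplacian a k).graph = floquetLaplacianGraph a k := by
  refine Submodule.toLinearPMap_graph_eq _ fun p hp h0 => ?_
  refine eq_zero_of_inner_blochWave ha k _ fun m => ?_
  rw [hp m, h0, inner_zero_right, mul_zero]

lemma IsRegular.exists_resolvent (ha : 0 < a) {k : Plane} {lam : ℂ} (h : IsRegular a k lam) :
    ∃ R : L2Cell a →L[ℂ] L2Cell a, ∀ f m, inner ℂ (blochWave a k m) (R f) =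
      (((‖dualVec a m + k‖ ^ 2 : ℝ) : ℂ) - lam)⁻¹ * inner ℂ (blochWave a k m) f := by
  obtain ⟨C, hC, hle⟩ := h.exists_norm_inv_le ha
  refine exists_multiplier ha k _ C fun m => (hle m).trans ?_
  refine mul_le_of_le_one_right hC (inv_le_one_of_one_le₀ ?_)
  have : 0 ≤ ‖dualVec a m + k‖ ^ 2 := by positivity
  linarith

theorem notMem_opSpectrum_floquetLaplacian_iff (ha : 0 < a) (k : Plane) (lam : ℂ) :
    lam ∉ opSpectrum (floquetLaplacian a k) ↔ IsRegular a k lam := by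
  rw [notMem_opSpectrum_iff, floquetLaplacian_graph ha]
  constructor
  · rintro ⟨R, -, hR⟩ m hm
    have hA : (areaCell a : ℂ) ≠ 0 := by exact_mod_cast (areaCell_pos ha).ne'
    have hmem : (blochWave a k m, lam • blochWave a k m) ∈ floquetLaplacianGraph a k := by
      intro n
      simp only [inner_smul_right, inner_blochWave_blochWave ha]
      split_ifs with hnm
      · rw [hnm, sub_eq_zero.1 hm]
      · simp
    have h0 : 0 = blochWave a k m := by simpa using hR _ hmem
    have h1 := inner_blochWave_blochWave ha k m m
    rw [if_pos rfl, ← h0, inner_zero_right] at h1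
    exact hA h1.symm
  · intro h
    obtain ⟨R, hR⟩ := h.exists_resolvent ha
    refine ⟨R, fun f m => ?_, fun p hp => ext_inner_blochWave ha k fun m => ?_⟩
    · have := h m
      simp only [inner_add_right, inner_smul_right, hR]
      field_simp
      ring
    · have := h m
      rw [hR, inner_sub_right, inner_smul_right, hp m]
      field_simp

/-- The superposition `∑_j q_j g_lam(• - y_j, k)` of Green's functions with charges `q`. -/
def chargeSum (a : ℝ) (k : Plane) (lam : ℂ) : (Fin 2 → ℂ) →ₗ[ℂ] L2Cell a :=
  Fintype.linearCombination ℂ fun j => greenL2 a k lam (site a j)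

lemma chargeSum_apply (a : ℝ) (k : Plane) (lam : ℂ) (q : Fin 2 → ℂ) :
    chargeSum a k lam q = ∑ j, q j • greenL2 a k lam (site a j) := rfl

/-- The `m`-th coefficient `∑_j q_j e^{-i(ξ_m+k)·y_j}` of the point charges `q`. -/
def chargeCoeff (a : ℝ) (k : Plane) (q : Fin 2 → ℂ) (m : ℤ × ℤ) : ℂ :=
  ∑ j, q j * planeWave (dualVec a m + k) (-site a j)

lemma inner_blochWave_chargeSum (ha : 0 < a) {k : Plane} {lam : ℂ} (h : IsRegular a k lam)
    (q : Fin 2 → ℂ) (m : ℤ × ℤ) :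
    inner ℂ (blochWave a k m) (chargeSum a k lam q) =
      chargeCoeff a k q m / (((‖dualVec a m + k‖ ^ 2 : ℝ) : ℂ) - lam) := by
  simp only [chargeSum_apply, inner_sum, inner_smul_right, inner_blochWave_greenL2 ha h,
    greenTerm, chargeCoeff, Finset.sum_div, mul_div_assoc]

lemma planeWave_dualVec_three_mul_add (ha : 0 < a) (k : Plane) (n : ℕ) (j : ℤ) :
    planeWave (dualVec a (3 * n + j, 0) + k) (-x₀ a) = planeWave (dualVec a (j, 0) + k) (-x₀ a) := by
  have h : dualVec a (3 * n + j, 0) + k = (3 * n : ℝ) • k₁ a + (dualVec a (j, 0) + k) := by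
    simp only [dualVec]
    push_cast
    module
  have h1 : planeWave ((3 * n : ℝ) • k₁ a) (-x₀ a) = 1 := by
    rw [planeWave_eq_one_iff]
    refine ⟨-(2 * n), ?_⟩
    rw [real_inner_smul_left, inner_neg_right, inner_k₁_x₀ ha]
    push_cast
    ring
  rw [h, planeWave_add_left, h1, one_mul]

/-- Point charges are not square integrable. -/
theorem eq_zero_of_inner_blochWave_eq_chargeCoeff (ha : 0 < a) {k : Plane} {f : L2Cell a}
    {q : Fin 2 → ℂ} (hf : ∀ m, inner ℂ (blochWave a k m) f = chargeCoeff a k q m) : q = 0 := by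
  have hlim : Tendsto (fun m => ‖chargeCoeff a k q m‖ ^ 2) cofinite (𝓝 0) := by
    have := (hasSum_norm_inner_blochWave_sq ha k f).summable.tendsto_cofinite_zero
    simpa only [hf] using this
  have hzero : ∀ j : ℤ, chargeCoeff a k q (j, 0) = 0 := by
    intro j
    have hinj : Function.Injective fun n : ℕ => ((3 * n + j, 0) : ℤ × ℤ) := by
      intro n n' h
      simp only [Prod.mk.injEq, and_true] at h
      omega
    have h1 := hlim.comp hinj.tendsto_cofinite
    have h2 : ∀ n : ℕ, chargeCoeff a k q (3 * n + j, 0) = chargeCoeff a k q (j, 0) := by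
      intro n
      simp only [chargeCoeff, Fin.sum_univ_two, site, Matrix.cons_val_zero, Matrix.cons_val_one,
        planeWave_dualVec_three_mul_add ha, neg_zero, planeWave_zero_right]
    simp only [Function.comp_def, h2] at h1
    have h3 := tendsto_nhds_unique h1 tendsto_const_nhds
    exact norm_eq_zero.1 (pow_eq_zero_iff two_ne_zero |>.1 h3.symm)
  have h0 := hzero 0
  have h1 := hzero 1
  have hd0 : dualVec a (0, 0) + k = k := by simp [dualVec]
  have hd1 : dualVec a (1, 0) + k = k₁ a + k := by simp [dualVec]
  simp only [chargeCoeff, Fin.sum_univ_two, site, Matrix.cons_val_zero, Matrix.cons_val_one,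
    neg_zero, planeWave_zero_right, mul_one, hd0, hd1, planeWave_add_left] at h0 h1
  set c := planeWave k (-x₀ a) with hc
  set w := planeWave (k₁ a) (-x₀ a) with hw
  have hc0 : c ≠ 0 := norm_ne_zero_iff.1 (by rw [hc, norm_planeWave]; exact one_ne_zero)
  have hw1 : w - 1 ≠ 0 := by
    rw [sub_ne_zero, hw, ← conj_planeWave]
    intro h
    exact planeWave_k₁_x₀_ne_one ha (by simpa using congrArg (starRingEnd ℂ) h)
  have hq1 : q 1 = 0 := by
    have : q 1 * (c * (w - 1)) = 0 := by linear_combination h1 - h0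
    simpa [hc0, hw1] using this
  have hq0 : q 0 = 0 := by simpa [hq1] using h0
  ext j
  fin_cases j
  · exact hq0
  · exact hq1

lemma chargeCoeff_zero (a : ℝ) (k : Plane) (m : ℤ × ℤ) : chargeCoeff a k 0 m = 0 := by
  simp [chargeCoeff]

lemma chargeSum_injective (ha : 0 < a) {k : Plane} {lam : ℂ} (h : IsRegular a k lam) :
    Function.Injective (chargeSum a k lam) := by
  rw [← LinearMap.ker_eq_bot, LinearMap.ker_eq_bot']
  intro q hq
  refine eq_zero_of_inner_blochWave_eq_chargeCoeff ha (k := k) (f := 0) fun m => ?_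
  have h1 := inner_blochWave_chargeSum ha h q m
  rw [hq, inner_zero_right, eq_comm, div_eq_zero_iff, or_iff_left (h m)] at h1
  rw [h1, inner_zero_right]

/-- `p = (ψ, h)` satisfies `-Δ(k) ψ = h + ∑_j q_j δ_{y_j}` with the boundary condition
`Γ_{α,Y}(lam, k)ᵀ q = ((-Δ(k) - lam)⁻¹ (h - lam ψ))(y_j)`. -/
def HasCharge (a : ℝ) (α : Fin 2 → ℝ) (k : Plane) (lam : ℂ) (p : L2Cell a × L2Cell a)
    (q : Fin 2 → ℂ) : Prop :=
  (∀ m, ((‖dualVec a m + k‖ ^ 2 : ℝ) : ℂ) * inner ℂ (blochWave a k m) p.1 =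
    inner ℂ (blochWave a k m) p.2 + chargeCoeff a k q m) ∧
  ∀ j, (Matrix.mulVec (gammaMatrix a α k lam).transpose q) j =
    inner ℂ (greenL2 a k (starRingEnd ℂ lam) (site a j)) (p.2 - lam • p.1)

lemma mulVec_gammaMatrix_transpose_sub (ha : 0 < a) (α : Fin 2 → ℝ) {k : Plane} {lam mu : ℂ}
    (h : IsRegular a k lam) (h' : IsRegular a k mu) (q : Fin 2 → ℂ) (j : Fin 2) :
    (Matrix.mulVec (gammaMatrix a α k mu).transpose q) j =
      (Matrix.mulVec (gammaMatrix a α k lam).transpose q) j +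
      (lam - mu) * inner ℂ (greenL2 a k (starRingEnd ℂ mu) (site a j)) (chargeSum a k lam q) := by
  simp only [Matrix.mulVec, dotProduct, chargeSum_apply, inner_sum, inner_smul_right,
    Finset.mul_sum, ← Finset.sum_add_distrib]
  refine Finset.sum_congr rfl fun i _ => ?_
  have hg := green_sub_green ha h h' (isSiteDifference_site a j i)
  simp only [Matrix.transpose_apply, gammaMatrix, Matrix.of_apply]
  linear_combination q i * hg

lemma inner_greenL2_sub (ha : 0 < a) {k : Plane} {lam mu : ℂ} (h : IsRegular a k lam)
    (h' : IsRegular a k mu) (y : Plane) {φ η : L2Cell a}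
    (hφ : ∀ m, (((‖dualVec a m + k‖ ^ 2 : ℝ) : ℂ) - lam) * inner ℂ (blochWave a k m) φ =
      inner ℂ (blochWave a k m) η) :
    inner ℂ (greenL2 a k (starRingEnd ℂ lam) y) η - inner ℂ (greenL2 a k (starRingEnd ℂ mu) y) η =
      (lam - mu) * inner ℂ (greenL2 a k (starRingEnd ℂ mu) y) φ := by
  have hA : (areaCell a : ℂ) ≠ 0 := by exact_mod_cast (areaCell_pos ha).ne'
  have h1 := (hasSum_inner_greenL2 ha h y η).sub (hasSum_inner_greenL2 ha h' y η)
  have h2 := (hasSum_inner_greenL2 ha h' y φ).mul_left (lam - mu)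
  have h3 := h1.unique (h2.congr_fun fun m => by
    have := h m
    have := h' m
    rw [← hφ, greenTerm, greenTerm]
    field_simp
    ring)
  refine mul_left_cancel₀ hA ?_
  rw [mul_sub, h3]
  ring

lemma HasCharge.sub_chargeSum (ha : 0 < a) {α : Fin 2 → ℝ} {k : Plane} {lam : ℂ}
    (h : IsRegular a k lam) {p : L2Cell a × L2Cell a} {q : Fin 2 → ℂ}
    (hp : HasCharge a α k lam p q) (m : ℤ × ℤ) :
    (((‖dualVec a m + k‖ ^ 2 : ℝ) : ℂ) - lam) *
        inner ℂ (blochWave a k m) (p.1 - chargeSum a k lam q) =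
      inner ℂ (blochWave a k m) (p.2 - lam • p.1) := by
  rw [inner_sub_right, inner_sub_right, inner_smul_right, inner_blochWave_chargeSum ha h, mul_sub,
    mul_div_cancel₀ _ (h m)]
  linear_combination hp.1 m

/-- The charges of an element of the graph do not depend on the spectral parameter. -/
theorem HasCharge.change (ha : 0 < a) {α : Fin 2 → ℝ} {k : Plane} {lam mu : ℂ}
    (h : IsRegular a k lam) (h' : IsRegular a k mu) {p : L2Cell a × L2Cell a} {q : Fin 2 → ℂ}
    (hp : HasCharge a α k lam p q) : HasCharge a α k mu p q := by
  refine ⟨hp.1, fun j => ?_⟩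
  have h1 := inner_greenL2_sub ha h h' (site a j) (hp.sub_chargeSum ha h)
  rw [mulVec_gammaMatrix_transpose_sub ha α h h', hp.2 j]
  have h2 : p.2 - mu • p.1 = (p.2 - lam • p.1) + (lam - mu) • p.1 := by module
  rw [inner_sub_right _ p.1] at h1
  rw [h2, inner_add_right, inner_smul_right]
  linear_combination h1

lemma hasCharge_chargeSum_iff (ha : 0 < a) (α : Fin 2 → ℝ) {k : Plane} {lam : ℂ}
    (h : IsRegular a k lam) (u : L2Cell a) (q : Fin 2 → ℂ) :
    HasCharge a α k lam (u, lam • u) q ↔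
      Matrix.mulVec (gammaMatrix a α k lam).transpose q = 0 ∧ chargeSum a k lam q = u := by
  rw [HasCharge, and_comm]
  refine and_congr ?_ ⟨fun hu => ext_inner_blochWave ha k fun m => ?_, ?_⟩
  · simp only [sub_self, inner_zero_right, funext_iff, Pi.zero_apply]
  · rw [inner_blochWave_chargeSum ha h, div_eq_iff (h m)]
    have := hu m
    rw [inner_smul_right] at this
    linear_combination -this
  · rintro rfl m
    have := h m
    rw [inner_smul_right, inner_blochWave_chargeSum ha h]
    field_simp
    ring

lemma gammaMatrix_conj (ha : 0 < a) (α : Fin 2 → ℝ) {k : Plane} {lam : ℂ}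
    (h : IsRegular a k lam) :
    gammaMatrix a α k (starRingEnd ℂ lam) = (gammaMatrix a α k lam).conjTranspose := by
  ext i j
  simp only [gammaMatrix, Matrix.conjTranspose_apply, Matrix.of_apply, ← starRingEnd_apply,
    map_sub, conj_green ha h (isSiteDifference_site a i j), neg_sub, eq_comm (a := j)]
  split_ifs with hij
  · rw [hij, Complex.conj_ofReal]
  · rw [map_zero]

lemma exists_mulVec_transpose_eq_zero {M : Matrix (Fin 2) (Fin 2) ℂ} (h : ¬IsUnit M.det) :
    ∃ q ≠ 0, Matrix.mulVec M.transpose q = 0 := by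
  rw [isUnit_iff_ne_zero, not_not] at h
  exact Matrix.exists_mulVec_eq_zero_iff.2 (by rwa [Matrix.det_transpose])

/-- `Γ_{α,Y}(lam, k)` is invertible for nonreal `lam`. -/
theorem isUnit_det_gammaMatrix_of_im_ne_zero (ha : 0 < a) (α : Fin 2 → ℝ) (k : Plane) {lam : ℂ}
    (hlam : lam.im ≠ 0) : IsUnit (gammaMatrix a α k lam).det := by
  have h := isRegular_of_im_ne_zero a k hlam
  by_contra hdet
  obtain ⟨q, hq0, hq⟩ := exists_mulVec_transpose_eq_zero hdet
  have hq' : ∀ j, starRingEnd ℂ (Matrix.mulVec (gammaMatrix a α k lam).transpose q j) = 0 :=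
    fun j => by rw [hq]; simp
  set ψ := chargeSum a k lam q with hψ
  have h1 : ∑ j, starRingEnd ℂ (q j) *
      Matrix.mulVec (gammaMatrix a α k (starRingEnd ℂ lam)).transpose q j =
      (lam - starRingEnd ℂ lam) * inner ℂ ψ ψ := by
    conv_rhs => rw [hψ, chargeSum_apply, sum_inner, ← chargeSum_apply, Finset.mul_sum]
    refine Finset.sum_congr rfl fun j _ => ?_
    rw [mulVec_gammaMatrix_transpose_sub ha α h h.conj, hq, Complex.conj_conj, inner_smul_left]
    simp only [Pi.zero_apply]
    ring
  have h2 : ∑ j, starRingEnd ℂ (q j) *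
      Matrix.mulVec (gammaMatrix a α k (starRingEnd ℂ lam)).transpose q j = 0 := by
    have h3 : ∑ j, starRingEnd ℂ (q j) *
        Matrix.mulVec (gammaMatrix a α k (starRingEnd ℂ lam)).transpose q j =
        ∑ j, q j * starRingEnd ℂ (Matrix.mulVec (gammaMatrix a α k lam).transpose q j) := by
      rw [gammaMatrix_conj ha α h]
      simp only [Matrix.mulVec, dotProduct, Fin.sum_univ_two, Matrix.transpose_apply,
        Matrix.conjTranspose_apply, ← starRingEnd_apply, map_add, map_mul]
      ring
    rw [h3]
    simp only [hq', mul_zero, Finset.sum_const_zero]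
  rw [h2, eq_comm, mul_eq_zero] at h1
  rcases h1 with h1 | h1
  · rw [Complex.sub_conj] at h1
    simp [hlam] at h1
  · rw [inner_self_eq_zero] at h1
    exact hq0 (chargeSum_injective ha h (by rw [← hψ, h1, map_zero]))

lemma kreinTerm_eq_chargeSum (a : ℝ) (α : Fin 2 → ℝ) (k : Plane) (lam : ℂ) (f : L2Cell a) :
    kreinTerm a α k lam f = chargeSum a k lam
      (Matrix.mulVec (gammaMatrix a α k lam)⁻¹.transpose
        fun j => inner ℂ (greenL2 a k (starRingEnd ℂ lam) (site a j)) f) := by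
  rw [kreinTerm, Finset.sum_comm, chargeSum_apply]
  simp only [Matrix.mulVec, dotProduct, Finset.sum_smul, Matrix.transpose_apply]

lemma mulVec_transpose_eq_iff {M : Matrix (Fin 2) (Fin 2) ℂ} (h : IsUnit M.det)
    (q u : Fin 2 → ℂ) : Matrix.mulVec M.transpose q = u ↔ q = Matrix.mulVec M⁻¹.transpose u := by
  have h' : IsUnit M.transpose.det := by rwa [Matrix.det_transpose]
  rw [Matrix.transpose_nonsing_inv]
  constructor
  · rintro rfl
    rw [Matrix.mulVec_mulVec, Matrix.nonsing_inv_mul _ h', Matrix.one_mulVec]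
  · rintro rfl
    rw [Matrix.mulVec_mulVec, Matrix.mul_nonsing_inv _ h', Matrix.one_mulVec]

lemma HasCharge.kreinTerm_eq {α : Fin 2 → ℝ} {k : Plane} {lam : ℂ}
    (hdet : IsUnit (gammaMatrix a α k lam).det) {p : L2Cell a × L2Cell a} {q : Fin 2 → ℂ}
    (hp : HasCharge a α k lam p q) :
    kreinTerm a α k lam (p.2 - lam • p.1) = chargeSum a k lam q := by
  rw [kreinTerm_eq_chargeSum, (mulVec_transpose_eq_iff hdet q _).1 (funext hp.2)]

lemma exists_hasCharge_of_eq_add_kreinTerm (ha : 0 < a) {α : Fin 2 → ℝ} {k : Plane} {lam : ℂ}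
    (h : IsRegular a k lam) (hdet : IsUnit (gammaMatrix a α k lam).det)
    {p : L2Cell a × L2Cell a} {φ : L2Cell a}
    (hφ : ∀ m, (((‖dualVec a m + k‖ ^ 2 : ℝ) : ℂ) - lam) * inner ℂ (blochWave a k m) φ =
      inner ℂ (blochWave a k m) (p.2 - lam • p.1))
    (hp : p.1 = φ + kreinTerm a α k lam (p.2 - lam • p.1)) : ∃ q, HasCharge a α k lam p q := by
  rw [kreinTerm_eq_chargeSum] at hp
  refine ⟨_, fun m => ?_, fun j => congrFun ((mulVec_transpose_eq_iff hdet _ _).2 rfl) j⟩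
  have h1 := congrArg (inner ℂ (blochWave a k m)) hp
  rw [inner_add_right, inner_blochWave_chargeSum ha h, ← sub_eq_iff_eq_add', eq_div_iff (h m)] at h1
  have h2 := hφ m
  rw [inner_sub_right, inner_smul_right] at h2
  linear_combination h1 + h2

/-- The graph of the point scatterer operator, for any regular spectral parameter. -/
theorem mem_pointScattererGraph_iff (ha : 0 < a) (α : Fin 2 → ℝ) {k : Plane} {lam : ℂ}
    (h : IsRegular a k lam) (p : L2Cell a × L2Cell a) :
    p ∈ pointScattererGraph a α k ↔ ∃ q, HasCharge a α k lam p q := by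
  constructor
  · intro hp
    have hI : Complex.I.im ≠ 0 := by simp
    have hreg := isRegular_of_im_ne_zero a k hI
    have hdet := isUnit_det_gammaMatrix_of_im_ne_zero ha α k hI
    obtain ⟨φ, hφ, hφ'⟩ :=
      hp Complex.I ((notMem_opSpectrum_floquetLaplacian_iff ha k _).2 hreg) hdet
    have hmem := (floquetLaplacian a k).mem_graph φ
    rw [floquetLaplacian_graph ha] at hmem
    obtain ⟨q, hq⟩ := exists_hasCharge_of_eq_add_kreinTerm ha hreg hdet (fun m => by
      rw [← hφ, inner_sub_right, inner_smul_right, hmem m]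
      ring) hφ'
    exact ⟨q, hq.change ha hreg h⟩
  · rintro ⟨q, hq⟩ mu hmu hdet
    rw [notMem_opSpectrum_floquetLaplacian_iff ha] at hmu
    have hq' := hq.change ha h hmu
    have hsub := hq'.sub_chargeSum ha hmu
    have hmem : (p.1 - chargeSum a k mu q,
        p.2 - mu • p.1 + mu • (p.1 - chargeSum a k mu q)) ∈ (floquetLaplacian a k).graph := by
      rw [floquetLaplacian_graph ha]
      intro m
      rw [inner_add_right, ← hsub m, inner_smul_right]
      ring
    obtain ⟨φ, hφ, hφ'⟩ := (LinearPMap.mem_graph_iff _).1 hmem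
    refine ⟨φ, ?_, ?_⟩
    · rw [hφ', hφ, add_sub_cancel_right]
    · rw [hφ, hq'.kreinTerm_eq hdet, sub_add_cancel]

theorem pointScatterer_graph (ha : 0 < a) (α : Fin 2 → ℝ) (k : Plane) :
    (pointScatterer a α k).graph = pointScattererGraph a α k := by
  refine Submodule.toLinearPMap_graph_eq _ fun p hp h0 => ?_
  obtain ⟨q, hq⟩ := (mem_pointScattererGraph_iff ha α (isRegular_neg_one a k) p).1 hp
  have h1 : ∀ m, inner ℂ (blochWave a k m) (-p.2) = chargeCoeff a k q m := by
    intro m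
    have := hq.1 m
    rw [h0, inner_zero_right, mul_zero] at this
    rw [inner_neg_right]
    linear_combination this
  have hq0 := eq_zero_of_inner_blochWave_eq_chargeCoeff ha h1
  refine neg_eq_zero.1 (eq_zero_of_inner_blochWave ha k _ fun m => ?_)
  rw [h1, hq0, chargeCoeff_zero]

lemma exists_continuousLinearMap_eq_kreinTerm (a : ℝ) (α : Fin 2 → ℝ) (k : Plane) (lam : ℂ) :
    ∃ K : L2Cell a →L[ℂ] L2Cell a, ∀ f, K f = kreinTerm a α k lam f := by
  refine ⟨∑ j : Fin 2, ∑ j' : Fin 2, ((gammaMatrix a α k lam)⁻¹ j j' •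
    innerSL ℂ (greenL2 a k (starRingEnd ℂ lam) (site a j))).smulRight
      (greenL2 a k lam (site a j')), fun f => ?_⟩
  simp [kreinTerm]

/-- Off the spectrum of the Laplacian, the spectrum of the point scatterer operator is the set of
zeros of `det Γ_{α,Y}`. -/
theorem mem_opSpectrum_pointScatterer_iff (ha : 0 < a) (α : Fin 2 → ℝ) {k : Plane} {lam : ℂ}
    (h : IsRegular a k lam) :
    lam ∈ opSpectrum (pointScatterer a α k) ↔ (gammaMatrix a α k lam).det = 0 := by
  rw [← not_iff_not, notMem_opSpectrum_iff, pointScatterer_graph ha, ← Ne, ← isUnit_iff_ne_zero]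
  constructor
  · rintro ⟨R, -, hR⟩
    by_contra hdet
    obtain ⟨q, hq0, hq⟩ := exists_mulVec_transpose_eq_zero hdet
    have hmem := (mem_pointScattererGraph_iff ha α h _).2
      ⟨q, (hasCharge_chargeSum_iff ha α h _ q).2 ⟨hq, rfl⟩⟩
    have h0 : 0 = chargeSum a k lam q := by simpa using hR _ hmem
    exact hq0 (chargeSum_injective ha h (by rw [map_zero, ← h0]))
  · intro hdet
    obtain ⟨R, hR⟩ := h.exists_resolvent ha
    obtain ⟨K, hK⟩ := exists_continuousLinearMap_eq_kreinTerm a α k lam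
    refine ⟨R + K, fun f => ?_, fun p hp => ?_⟩
    · rw [mem_pointScattererGraph_iff ha α h]
      refine exists_hasCharge_of_eq_add_kreinTerm ha h hdet (φ := R f) (fun m => ?_) ?_
      · rw [add_sub_cancel_right, hR, mul_inv_cancel_left₀ (h m)]
      · rw [add_sub_cancel_right, ← hK, add_apply]
    · obtain ⟨q, hq⟩ := (mem_pointScattererGraph_iff ha α h p).1 hp
      rw [add_apply, hK, hq.kreinTerm_eq hdet, ← eq_sub_iff_add_eq]
      refine ext_inner_blochWave ha k fun m => ?_
      rw [hR, ← hq.sub_chargeSum ha h, inv_mul_cancel_left₀ (h m)]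

lemma map_opEigenspace_pointScatterer (ha : 0 < a) (α : Fin 2 → ℝ) {k : Plane} {lam : ℂ}
    (h : IsRegular a k lam) :
    (opEigenspace (pointScatterer a α k) lam).map (pointScatterer a α k).domain.subtype =
      (LinearMap.ker (gammaMatrix a α k lam).transpose.mulVecLin).map (chargeSum a k lam) := by
  ext u
  rw [mem_map_opEigenspace_iff, pointScatterer_graph ha, mem_pointScattererGraph_iff ha α h,
    Submodule.mem_map]
  exact exists_congr fun q => hasCharge_chargeSum_iff ha α h u q

lemma rank_ker_transpose_mulVecLin (M : Matrix (Fin 2) (Fin 2) ℂ) :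
    Module.rank ℂ (LinearMap.ker M.transpose.mulVecLin) =
      Module.rank ℂ (LinearMap.ker M.mulVecLin) := by
  rw [← Module.finrank_eq_rank, ← Module.finrank_eq_rank, Nat.cast_inj]
  have h1 := M.mulVecLin.finrank_range_add_finrank_ker
  have h2 := M.transpose.mulVecLin.finrank_range_add_finrank_ker
  have h3 : Module.finrank ℂ (LinearMap.range M.transpose.mulVecLin) =
    Module.finrank ℂ (LinearMap.range M.mulVecLin) := Matrix.rank_transpose M
  omega

theorem rank_opEigenspace_pointScatterer (ha : 0 < a) (α : Fin 2 → ℝ) {k : Plane} {lam : ℂ}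
    (h : IsRegular a k lam) :
    Module.rank ℂ (opEigenspace (pointScatterer a α k) lam) =
      Module.rank ℂ (LinearMap.ker (gammaMatrix a α k lam).mulVecLin) := by
  have h1 := (Submodule.equivMapOfInjective _ (pointScatterer a α k).domain.subtype_injective
    (opEigenspace (pointScatterer a α k) lam)).rank_eq
  have h2 := LinearEquiv.lift_rank_eq (Submodule.equivMapOfInjective _ (chargeSum_injective ha h)
    (LinearMap.ker (gammaMatrix a α k lam).transpose.mulVecLin))
  rw [Cardinal.lift_id, Cardinal.lift_id] at h2
  rw [h1, map_opEigenspace_pointScatterer ha α h, ← h2, rank_ker_transpose_mulVecLin]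

lemma det_gammaMatrix (a α : ℝ) (k : Plane) (lam : ℂ) :
    (gammaMatrix a (fun _ => α) k lam).det =
      (α - green a k lam 0) ^ 2 - green a k lam (x₀ a) * green a k lam (-x₀ a) := by
  rw [Matrix.det_fin_two]
  simp [gammaMatrix, site]
  ring

lemma green_zero_ne_ofReal (ha : 0 < a) (k : Plane) {lam : ℂ} (hlam : lam.im ≠ 0) (s : ℝ) :
    green a k lam 0 ≠ s := by
  intro hs
  have h := isRegular_of_im_ne_zero a k hlam
  have h1 := green_sub_green ha h h.conj (y := 0) (y' := 0) (Or.inl (sub_zero 0))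
  have h2 := conj_green ha h (x := 0) (Or.inl rfl)
  rw [neg_zero] at h2
  rw [sub_zero, ← h2, hs, Complex.conj_ofReal, sub_self, Complex.conj_conj, eq_comm,
    mul_eq_zero, inner_self_eq_zero, Complex.sub_conj] at h1
  rcases h1 with h1 | h1
  · simp [hlam] at h1
  · have h3 := inner_blochWave_greenL2 ha h 0 0
    rw [h1, inner_zero_right, neg_zero, greenTerm, planeWave_zero_right, eq_comm] at h3
    exact one_div_ne_zero (h 0) h3

theorem det_gammaMatrix_eq_zero_iff (ha : 0 < a) (α : ℝ) {k : Plane} {lam : ℂ}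
    (h : IsRegular a k lam) :
    (gammaMatrix a (fun _ => α) k lam).det = 0 ↔
      (α : ℂ) = green a k lam 0 + (‖green a k lam (x₀ a)‖ : ℂ) ∨
      (α : ℂ) = green a k lam 0 - (‖green a k lam (x₀ a)‖ : ℂ) := by
  by_cases hlam : lam.im = 0
  · have hconj := conj_green ha h (x := x₀ a) (Or.inr (Or.inl rfl))
    rw [Complex.conj_eq_iff_im.2 hlam] at hconj
    rw [det_gammaMatrix, ← hconj, Complex.mul_conj, Complex.normSq_eq_norm_sq, sub_eq_zero,
      Complex.ofReal_pow, sq_eq_sq_iff_eq_or_eq_neg, sub_eq_iff_eq_add', sub_eq_iff_eq_add',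
      ← sub_eq_add_neg]
  · refine iff_of_false (isUnit_det_gammaMatrix_of_im_ne_zero ha _ k hlam).ne_zero ?_
    rintro (h1 | h1)
    · refine green_zero_ne_ofReal ha k hlam (α - ‖green a k lam (x₀ a)‖) ?_
      rw [Complex.ofReal_sub, h1, add_sub_cancel_right]
    · refine green_zero_ne_ofReal ha k hlam (α + ‖green a k lam (x₀ a)‖) ?_
      rw [Complex.ofReal_add, h1, sub_add_cancel]

end PointCharges

end HoneycombPointScatterer

end

theorem mainTheorem8 (a : ℝ) (ha : 0 < a) (α : ℝ) (k : HoneycombPointScatterer.Plane) (lam : ℂ)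
    (hlam : lam ∉ HoneycombPointScatterer.opSpectrum
      (HoneycombPointScatterer.floquetLaplacian a k)) :
    (lam ∈ HoneycombPointScatterer.opSpectrum
        (HoneycombPointScatterer.pointScatterer a (fun _ => α) k) ↔
      (α : ℂ) = HoneycombPointScatterer.green a k lam 0 +
          (‖HoneycombPointScatterer.green a k lam (HoneycombPointScatterer.x₀ a)‖ : ℂ) ∨
      (α : ℂ) = HoneycombPointScatterer.green a k lam 0 -
          (‖HoneycombPointScatterer.green a k lam (HoneycombPointScatterer.x₀ a)‖ : ℂ)) ∧
    Module.rank ℂ (HoneycombPointScatterer.opEigenspace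
        (HoneycombPointScatterer.pointScatterer a (fun _ => α) k) lam) =
      Module.rank ℂ (LinearMap.ker
        (HoneycombPointScatterer.gammaMatrix a (fun _ => α) k lam).mulVecLin) := by
  rw [HoneycombPointScatterer.notMem_opSpectrum_floquetLaplacian_iff ha] at hlam
  rw [HoneycombPointScatterer.mem_opSpectrum_pointScatterer_iff ha _ hlam]
  exact ⟨HoneycombPointScatterer.det_gammaMatrix_eq_zero_iff ha α hlam,
    HoneycombPointScatterer.rank_opEigenspace_pointScatterer ha _ hlam⟩
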